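/- Let $p\ge 0$ and let $v_0,\dots,v_{p+4}\in\mathbb Z^4$ be lattice points with $v_0=0$ and $v_j=e_j$ (the $j$-th standard basis vector) for $1\le j\le 4$; for instance, all the lattice points of the integral polytope $\Delta^*$ that gives the anticanonical monomials of a toric Calabi–Yau hypersurface in toric coordinates $X=(X_1,\dots,X_4)$. For $a=(a_0,\dots,a_{p+4})$ put $$f_a(X)=\sum_{k} a_kX^{v_k},\qquad \Pi(a)=\frac1{f_a(X)}\,\frac{dX_1}{X_1}\wedge\cdots\wedge\frac{dX_4}{X_4},\qquad \phi_a:X_j\mapsto \frac{a_0}{a_j}X_j\ (1\le j\le 4),\qquad \tilde\Pi=a_0\,\phi_a^*\Pi(a).$$ Let $L=\{l\in\mathbb Z^{p+5}:\sum_i l_i=0,\ \sum_i l_iv_i=0\}$, and for $l\in L$ let, with $\theta_i=a_i\frac{\partial}{\partial a_i}$, $a^l=\prod_i a_i^{l_i}$ and empty products equal to $1$, $$\tilde D_l=\prod_{j=1}^{l_0}(\theta_0-j)\prod_{i\ne0,\,l_i>0}\ \prod_{j=0}^{l_i-1}(\theta_i-j)-a^l\prod_{j=1}^{-l_0}(\theta_0-j)\prod_{i\ne0,\,l_i<0}\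 \prod_{j=0}^{-l_i-1}(\theta_i-j).$$ Let $\mathcal L_V$ and $\iota_V$ denote the Lie derivative and the contraction of differential forms in $X$ along a vector field $V$, and $d$ the exterior derivative in $X$. Let $U_l$ be the set of all $(a,X)$ with $a_0,\dots,a_4\neq0$, $a_i\ne0$ whenever $l_i<0$, $X\in(\mathbb C^*)^4$ and $f_a(\phi_a(X))\neq0$. Then $\tilde\Pi$ is holomorphic on $U_l$, and there: (1) $\tilde\Pi$ is annihilated by the operator $\tilde D_l'$ obtained from $\tilde D_l$ by the substitutions $$\theta_0\mapsto\theta_0'=\theta_0-\mathcal L_{\sum_{j=1}^4X_j\partial_{X_j}},\qquad \theta_j\mapsto\theta_j'=\theta_j+\mathcal L_{X_j\partial_{X_j}}\ (1\le j\le4),\qquad \theta_i\mapsto\theta_i'=\theta_i\ (i>4).$$ (2) Put $c_{0j}=-1$ and, for $i\ge 1$, $c_{ij}=1$ if $i=j$ and $c_{ij}=0$ otherwise. List the factors of the first product in $\tilde D_l$ as $\theta_{i_1}-s_1,\dots,\theta_{i_r}-s_r$, with $i_1\le\dots\le i_r$ and increasing $s$ for equal $i$, and put $$A_j^+=\sum_{m=1}^{r}c_{i_mj}\,(\theta_{i_1}-s_1)\cdots(\theta_{i_{m-1}}-s_{m-1})\,(\theta'_{i_{m+1}}-s_{m+1})\cdots(\theta'_{i_r}-s_r)\,\tilde\Pi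 ;$$ let $A_j^-$ be the same expression for the product that follows $a^l$, and $\alpha_j=A_j^+-a^lA_j^-$ for $1\le j\le 4$. The $\alpha_j$ are holomorphic $d$-closed $4$-forms (in $X$) and $$\tilde D_l\tilde\Pi=-\sum_{j=1}^4\mathcal L_{X_j\partial_{X_j}}\alpha_j .$$ Hence $\beta_l=\sum_{j=1}^4\iota_{X_j\partial_{X_j}}\alpha_j$ is a holomorphic $3$-form with $$\tilde D_l\tilde\Pi=-d\beta_l .$$ -/

import Mathlib

/-- The space `ℂ⁴` of the toric coordinates `X = (X₁, …, X₄)`. -/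
abbrev ToricSpace : Type := Fin 4 → ℂ

/-- The space of coefficient vectors `a = (a₀, …, a_{p+4})`. -/
abbrev ParamSpace (p : ℕ) : Type := Fin (p + 5) → ℂ

/-- Holomorphic `k`-forms in the toric coordinates `X` depending on the parameters `a`
(only their values where they are holomorphic are meaningful). -/
abbrev FormFamily (p k : ℕ) : Type := ParamSpace p → ToricSpace → ToricSpace [⋀^Fin k]→L[ℂ] ℂ

/-- The index `j ∈ {1, …, 4}` among `{0, …, p + 4}`, for the `j`-th toric coordinate. -/
def coordIdx (p : ℕ) (j : Fin 4) : Fin (p + 5) := ⟨j.val + 1, by omega⟩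

/-- The Laurent monomial `X ^ m`. -/
noncomputable def laurentMonomial {ι : Type*} [Fintype ι] (x : ι → ℂ) (m : ι → ℤ) : ℂ :=
  ∏ i, x i ^ m i

/-- The Laurent polynomial `f(X) = ∑ₖ aₖ X ^ vₖ`. -/
noncomputable def hypersurfaceEq {p : ℕ} (v : Fin (p + 5) → Fin 4 → ℤ)
    (a : ParamSpace p) (X : ToricSpace) : ℂ :=
  ∑ k, a k * laurentMonomial X (v k)

/-- The constant form `dX₁ ∧ dX₂ ∧ dX₃ ∧ dX₄`, that is `(w₁, …, w₄) ↦ det (wᵢ)ⱼ`. -/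
noncomputable def volumeForm : ToricSpace [⋀^Fin 4]→L[ℂ] ℂ :=
  { (Matrix.detRowAlternating : ToricSpace [⋀^Fin 4]→ₗ[ℂ] ℂ) with
    cont := by
      change Continuous fun M : Matrix (Fin 4) (Fin 4) ℂ => M.det
      exact Continuous.matrix_det continuous_id }

/-- The form `Π(a) = f(X)⁻¹ (dX₁ / X₁) ∧ ⋯ ∧ (dX₄ / X₄)`. -/
noncomputable def periodForm {p : ℕ} (v : Fin (p + 5) → Fin 4 → ℤ) : FormFamily p 4 :=
  fun a X => ((hypersurfaceEq v a X)⁻¹ * (∏ j, X j)⁻¹) • volumeForm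

/-- Pullback of a differential form under a map. -/
noncomputable def pullbackForm {k : ℕ} (φ : ToricSpace → ToricSpace)
    (ω : ToricSpace → ToricSpace [⋀^Fin k]→L[ℂ] ℂ) : ToricSpace → ToricSpace [⋀^Fin k]→L[ℂ] ℂ :=
  fun X => (ω (φ X)).compContinuousLinearMap (fderiv ℂ φ X)

/-- The torus automorphism `φ : Xⱼ ↦ (a₀ / aⱼ) Xⱼ`. -/
noncomputable def torusAut {p : ℕ} (a : ParamSpace p) : ToricSpace → ToricSpace :=
  fun X j => a 0 / a (coordIdx p j) * X j

/-- The form `Π̃ = a₀ φ^* Π(a)`. -/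
noncomputable def modifiedPeriodForm {p : ℕ} (v : Fin (p + 5) → Fin 4 → ℤ) : FormFamily p 4 :=
  fun a X => a 0 • pullbackForm (torusAut a) (periodForm v a) X

/-- The lattice `L` of relations `∑ᵢ lᵢ (1, vᵢ) = 0`. -/
def relationLattice {p : ℕ} (v : Fin (p + 5) → Fin 4 → ℤ) :
    Submodule ℤ (Fin (p + 5) → ℤ) :=
  LinearMap.ker (Fintype.linearCombination ℤ fun i => ((1 : ℤ), v i))

/-- The operator `aᵢ ∂/∂aᵢ` on families of forms (with `X` fixed). -/
noncomputable def eulerOp {p k : ℕ} (i : Fin (p + 5)) (ω : FormFamily p k) : FormFamily p k :=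
  fun a X => a i • deriv (fun t => ω (Function.update a i t) X) (a i)

/-- The Lie derivative of a form along a vector field `V`:
`(L_V ω)(w₁, …, w_k) = (D_V ω)(w₁, …, w_k) + ∑ᵢ ω(w₁, …, D_{wᵢ} V, …, w_k)`. -/
noncomputable def lieDerivForm {k : ℕ} (V : ToricSpace → ToricSpace)
    (ω : ToricSpace → ToricSpace [⋀^Fin k]→L[ℂ] ℂ) : ToricSpace → ToricSpace [⋀^Fin k]→L[ℂ] ℂ :=
  fun X => fderiv ℂ ω X (V X) +
    (ω X).fderivCompContinuousLinearMap (ContinuousLinearMap.id ℂ ToricSpace) (fderiv ℂ V X)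

/-- The contraction `ι_V ω = ω(V, ·, …, ·)`. -/
noncomputable def contractForm {k : ℕ} (V : ToricSpace → ToricSpace)
    (ω : ToricSpace → ToricSpace [⋀^Fin (k + 1)]→L[ℂ] ℂ) :
    ToricSpace → ToricSpace [⋀^Fin k]→L[ℂ] ℂ :=
  fun X => (ω X).curryLeft (V X)

/-- The vector field `Xⱼ ∂/∂Xⱼ`. -/
noncomputable def coordField (j : Fin 4) : ToricSpace → ToricSpace := fun X => Pi.single j (X j)

/-- The vector field `∑ⱼ Xⱼ ∂/∂Xⱼ`. -/
noncomputable def radialField : ToricSpace → ToricSpace := fun X => ∑ j, coordField j X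

/-- The operators replacing `aᵢ ∂/∂aᵢ`: `a₀ ∂/∂a₀ - L_{∑ Xⱼ ∂/∂Xⱼ}` for `i = 0`,
`aⱼ ∂/∂aⱼ + L_{Xⱼ ∂/∂Xⱼ}` for `i = j ∈ {1, …, 4}`, and `aᵢ ∂/∂aᵢ` for `i > 4`. -/
noncomputable def substOp {p k : ℕ} (i : Fin (p + 5)) (ω : FormFamily p k) : FormFamily p k :=
  fun a X =>
    if i = 0 then eulerOp i ω a X - lieDerivForm radialField (ω a) X
    else if h : i.val - 1 < 4 then
      eulerOp i ω a X + lieDerivForm (coordField ⟨i.val - 1, h⟩) (ω a) X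
    else eulerOp i ω a X

/-- For `m : {0, …, p + 4} → ℕ`, the list of the pairs `(i, c)` such that `aᵢ ∂/∂aᵢ - c` is a factor
of `∏_{j=1}^{m₀} (a₀ ∂/∂a₀ - j) ∏_{i ≠ 0} ∏_{j=0}^{mᵢ-1} (aᵢ ∂/∂aᵢ - j)`, in this order. -/
def gkzFactors {p : ℕ} (m : Fin (p + 5) → ℕ) : List (Fin (p + 5) × ℕ) :=
  (List.finRange (p + 5)).flatMap fun i =>
    (List.range (m i)).map fun j => (i, if i = 0 then j + 1 else j)

/-- The composite of the operators `T i - c` over a list of pairs `(i, c)`, the head acting last. -/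
noncomputable def composeFactors {p k : ℕ} (T : Fin (p + 5) → FormFamily p k → FormFamily p k)
    (fs : List (Fin (p + 5) × ℕ)) (ω : FormFamily p k) : FormFamily p k :=
  fs.foldr (fun f η => T f.1 η - (f.2 : ℂ) • η) ω

/-- The operator obtained from
`∏_{j=1}^{l₀} (t₀ - j) ∏_{i≠0, lᵢ>0} ∏_{j=0}^{lᵢ-1} (tᵢ - j)
  - a^l ∏_{j=1}^{-l₀} (t₀ - j) ∏_{i≠0, lᵢ<0} ∏_{j=0}^{-lᵢ-1} (tᵢ - j)` at `tᵢ = T i`. -/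
noncomputable def gkzOp {p k : ℕ} (l : Fin (p + 5) → ℤ)
    (T : Fin (p + 5) → FormFamily p k → FormFamily p k) (ω : FormFamily p k) : FormFamily p k :=
  fun a X => composeFactors T (gkzFactors fun i => (l i).toNat) ω a X -
    laurentMonomial a l • composeFactors T (gkzFactors fun i => (-l i).toNat) ω a X

/-- The coefficient of `L_{Xⱼ ∂/∂Xⱼ}` in `substOp i - eulerOp i`. -/
noncomputable def lieCoeff (p : ℕ) (i : Fin (p + 5)) (j : Fin 4) : ℂ :=
  if i = 0 then -1 else if i = coordIdx p j then 1 else 0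

/-- The coefficient forms of the `L_{Xⱼ ∂/∂Xⱼ}` when the terms with a Lie derivative are collected in
the product of the substituted factors: expanding the factors from the left to the right,
`∏ (substOp i - c) ω = ∏ (eulerOp i - c) ω + ∑ⱼ L_{Xⱼ ∂/∂Xⱼ} (collectLie fs j ω)`. -/
noncomputable def collectLie {p k : ℕ} (j : Fin 4) (ω : FormFamily p k) :
    List (Fin (p + 5) × ℕ) → FormFamily p k
  | [] => 0
  | (i, c) :: fs => eulerOp i (collectLie j ω fs) - (c : ℂ) • collectLie j ω fs +
      lieCoeff p i j • composeFactors substOp fs ω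

/-- The forms `αⱼ`, `1 ≤ j ≤ 4`: the coefficients of `L_{Xⱼ ∂/∂Xⱼ}` when all terms with a Lie
derivative are collected in the substituted operator applied to `Π̃`. -/
noncomputable def alphaForm {p : ℕ} (v : Fin (p + 5) → Fin 4 → ℤ) (l : Fin (p + 5) → ℤ)
    (j : Fin 4) : FormFamily p 4 :=
  fun a X => collectLie j (modifiedPeriodForm v) (gkzFactors fun i => (l i).toNat) a X -
    laurentMonomial a l •
      collectLie j (modifiedPeriodForm v) (gkzFactors fun i => (-l i).toNat) a X

/-- The form `β_l = ∑ⱼ ι_{Xⱼ ∂/∂Xⱼ} αⱼ`. -/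
noncomputable def betaForm {p : ℕ} (v : Fin (p + 5) → Fin 4 → ℤ) (l : Fin (p + 5) → ℤ) :
    FormFamily p 3 :=
  fun a X => ∑ j, contractForm (k := 3) (coordField j) (alphaForm v l j a) X

/-- The points `(a, X)` at which `φ`, `a^l` and `Π̃` are regular: `a₀, …, a₄ ≠ 0`, `aᵢ ≠ 0` whenever
`lᵢ < 0`, `X ∈ (ℂ^*)⁴`, and `X` is off the transformed hypersurface `f(φ(X)) = 0`. -/
def regularLocus {p : ℕ} (v : Fin (p + 5) → Fin 4 → ℤ) (l : Fin (p + 5) → ℤ) :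
    Set (ParamSpace p × ToricSpace) :=
  {q | (∀ i : Fin (p + 5), i.val ≤ 4 ∨ l i < 0 → q.1 i ≠ 0) ∧ (∀ j, q.2 j ≠ 0) ∧
    hypersurfaceEq v q.1 (torusAut q.1 q.2) ≠ 0}

/-! Write `f ∘ φ` as a sum of monomials `u_k = a_k φ(X)^{v_k}`. On a top form `g dX₁ ∧ ⋯ ∧ dX₄` the
Lie derivative along `Xⱼ ∂/∂Xⱼ` acts as `g ↦ Xⱼ ∂g/∂Xⱼ + g`, so the substituted operator `θᵢ'` is
the derivation along `aᵢ ∂/∂aᵢ + ∑ⱼ cᵢⱼ Xⱼ ∂/∂Xⱼ` plus the scalar `∑ⱼ cᵢⱼ`. The `cᵢⱼ` are exactly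
those for which this field kills every coordinate `(a₀ / aⱼ) Xⱼ` of `φ`, so it multiplies `u_k` by
`δᵢₖ`. Put `P_m = (-1)^|m| |m|! a₀ u^m / (∏ Xⱼ · (f ∘ φ)^(|m|+1))` times the volume form
(`derivedPeriod`), so that `Π̃ = P_0`. Then `(θᵢ' - δᵢ₀ - mᵢ) P_m = P_{m + eᵢ}`
(`weightedDeriv_derivedPeriod`); the prefactor `a₀` is what shifts the factors in `θ₀`. The two
products of the substituted operator thus send `Π̃` to `P_{l⁺}` and `P_{l⁻}`
(`composeList_gkzFactors`), and `P_{l⁺} = a^l P_{l⁻}` by the lattice relations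
(`derivedPeriod_relation`). This is (1). For (2), the Euler operators commute with the Lie
derivatives, so expanding the substituted products moves every Lie derivative to the front and
leaves the `αⱼ` (`composeList_eq_add_sum`). Cartan's formula, with `dαⱼ = 0` for reasons of degree,
turns the Lie derivatives into `dβ_l`. -/

/-! ### Derivatives along linear vector fields `q ↦ w * q`. -/

section WeightedDerivative

variable {E F : Type*} [NormedCommRing E] [NormedAlgebra ℂ E]
  [NormedAddCommGroup F] [NormedSpace ℂ F]

/-- The derivative of `g` along the vector field `q ↦ w * q`. -/
noncomputable def weightedDeriv (w : E) (g : E → F) : E → F :=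
  fun q => fderiv ℂ g q (w * q)

theorem AnalyticOnNhd.weightedDeriv [CompleteSpace F] {U : Set E} {g : E → F}
    (hg : AnalyticOnNhd ℂ g U) (w : E) : AnalyticOnNhd ℂ (weightedDeriv w g) U := by
  intro q hq
  have h1 := hg.fderiv q hq
  have h2 : AnalyticAt ℂ (fun q : E => w * q) q := analyticAt_const.mul analyticAt_id
  exact (ContinuousLinearMap.apply ℂ F : E →L[ℂ] (E →L[ℂ] F) →L[ℂ] F).analyticAt_bilinear (_, _)
    |>.comp₂ h2 h1

theorem Filter.EventuallyEq.weightedDeriv_eq {g h : E → F} {q : E} (H : g =ᶠ[nhds q] h) (w : E) :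
    weightedDeriv w g q = weightedDeriv w h q := by
  simp only [weightedDeriv, H.fderiv_eq]

theorem weightedDeriv_add {g h : E → F} {q : E} (hg : DifferentiableAt ℂ g q)
    (hh : DifferentiableAt ℂ h q) (w : E) :
    weightedDeriv w (fun x => g x + h x) q = weightedDeriv w g q + weightedDeriv w h q := by
  simp [weightedDeriv, fderiv_fun_add hg hh]

theorem weightedDeriv_const_smul {g : E → F} {q : E} (hg : DifferentiableAt ℂ g q) (c : ℂ)
    (w : E) : weightedDeriv w (fun x => c • g x) q = c • weightedDeriv w g q := by
  simp [weightedDeriv, fderiv_fun_const_smul hg]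

/-- The fields `w * q` commute because multiplication does: the first-order terms agree, and the
second-order terms agree by symmetry of the second derivative. -/
theorem weightedDeriv_comm {g : E → F} {q : E} (hg : ContDiffAt ℂ 2 g q) (w w' : E) :
    weightedDeriv w (weightedDeriv w' g) q = weightedDeriv w' (weightedDeriv w g) q := by
  have hd : DifferentiableAt ℂ (fderiv ℂ g) q :=
    (hg.fderiv_right (m := 1) (by norm_num)).differentiableAt (by norm_num)
  have key : ∀ w w' : E, weightedDeriv w (weightedDeriv w' g) q =
      fderiv ℂ (fderiv ℂ g) q (w * q) (w' * q) + fderiv ℂ g q (w' * (w * q)) := by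
    intro w w'
    have h1 : HasFDerivAt (fun x : E => w' * x) (ContinuousLinearMap.mul ℂ E w') q :=
      (ContinuousLinearMap.mul ℂ E w').hasFDerivAt
    have h2 := hd.hasFDerivAt.clm_apply h1
    change fderiv ℂ (fun x => fderiv ℂ g x (w' * x)) q (w * q) = _
    rw [h2.fderiv]
    simp [add_comm]
  rw [key, key, (hg.isSymmSndFDerivAt (by simp)).eq (w * q) (w' * q), mul_left_comm]

/-- `g` is differentiable at `q`, with derivative `g'` along the vector field `q ↦ w * q`. -/
def HasWeightedDerivAt (w : E) (g : E → F) (g' : F) (q : E) : Prop :=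
  DifferentiableAt ℂ g q ∧ fderiv ℂ g q (w * q) = g'

namespace HasWeightedDerivAt

variable {w q : E}

theorem smul {g : E → ℂ} {h : E → F} {g' : ℂ} {h' : F} (hg : HasWeightedDerivAt w g g' q)
    (hh : HasWeightedDerivAt w h h' q) :
    HasWeightedDerivAt w (fun x => g x • h x) (g q • h' + g' • h q) q := by
  refine ⟨hg.1.smul hh.1, ?_⟩
  rw [fderiv_fun_smul hg.1 hh.1]
  simp [← hg.2, ← hh.2]

theorem mul {g h : E → ℂ} {g' h' : ℂ} (hg : HasWeightedDerivAt w g g' q)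
    (hh : HasWeightedDerivAt w h h' q) :
    HasWeightedDerivAt w (fun x => g x * h x) (g q * h' + g' * h q) q := by
  simpa using hg.smul hh

theorem comp {φ : ℂ → ℂ} {φ' : ℂ} {g : E → ℂ} {g' : ℂ} (hg : HasWeightedDerivAt w g g' q)
    (hφ : HasDerivAt φ φ' (g q)) : HasWeightedDerivAt w (fun x => φ (g x)) (φ' * g') q := by
  have h := hφ.comp_hasFDerivAt q hg.1.hasFDerivAt
  refine ⟨h.differentiableAt, ?_⟩
  rw [show (fun x => φ (g x)) = φ ∘ g from rfl, h.fderiv]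
  simp [← hg.2]

theorem const (c : F) : HasWeightedDerivAt w (fun _ => c) 0 q :=
  ⟨differentiableAt_const c, by simp⟩

theorem clm (f : E →L[ℂ] F) : HasWeightedDerivAt w (fun x => f x) (f (w * q)) q :=
  ⟨f.differentiableAt, by rw [f.fderiv]⟩

theorem sum {ι : Type*} {s : Finset ι} {g : ι → E → F} {g' : ι → F}
    (h : ∀ i ∈ s, HasWeightedDerivAt w (g i) (g' i) q) :
    HasWeightedDerivAt w (fun x => ∑ i ∈ s, g i x) (∑ i ∈ s, g' i) q := by
  refine ⟨DifferentiableAt.fun_sum fun i hi => (h i hi).1, ?_⟩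
  rw [fderiv_fun_sum fun i hi => (h i hi).1, _root_.sum_apply]
  exact Finset.sum_congr rfl fun i hi => (h i hi).2

/-- Eigenfunctions multiply and their weights add. The eigenvalue form `c i * g i q` avoids
logarithmic derivatives, so factors may vanish. -/
theorem prod {ι : Type*} {s : Finset ι} {g : ι → E → ℂ} {c : ι → ℂ}
    (h : ∀ i ∈ s, HasWeightedDerivAt w (g i) (c i * g i q) q) :
    HasWeightedDerivAt w (fun x => ∏ i ∈ s, g i x) ((∑ i ∈ s, c i) * ∏ i ∈ s, g i q) q := by
  classical
  induction s using Finset.induction_on with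
  | empty => simpa using const (w := w) (q := q) (1 : ℂ)
  | insert a s ha ih =>
    have h1 := (h a (Finset.mem_insert_self a s)).mul
      (ih fun i hi => h i (Finset.mem_insert_of_mem hi))
    simp only [Finset.prod_insert ha, Finset.sum_insert ha]
    convert h1 using 1
    ring

theorem zpow {g : E → ℂ} {c : ℂ} (h : HasWeightedDerivAt w g (c * g q) q) (h0 : g q ≠ 0) (n : ℤ) :
    HasWeightedDerivAt w (fun x => g x ^ n) (n * c * g q ^ n) q := by
  have h1 := h.comp (hasDerivAt_zpow n (g q) (Or.inl h0))
  convert h1 using 1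
  rw [zpow_sub_one₀ h0]
  field_simp

/-- Natural powers are treated apart from `zpow` because `u_k` vanishes where `a_k = 0`, which is
allowed for `k > 4` with `l_k ≥ 0`. -/
theorem pow {g : E → ℂ} {c : ℂ} (h : HasWeightedDerivAt w g (c * g q) q) (n : ℕ) :
    HasWeightedDerivAt w (fun x => g x ^ n) (n * c * g q ^ n) q := by
  have h1 := h.comp (hasDerivAt_pow n (g q))
  convert h1 using 1
  rcases n with _ | n
  · simp
  · simp [pow_succ]; ring

end HasWeightedDerivAt

end WeightedDerivative

/-! ### Cartan's formula. -/

section Cartan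

theorem HasFDerivAt.comp_linearIsometry {A B G : Type*} [NormedAddCommGroup A] [NormedSpace ℂ A]
    [NormedAddCommGroup B] [NormedSpace ℂ B] [NormedAddCommGroup G] [NormedSpace ℂ G]
    (L : A →ₗᵢ[ℂ] B) {ω : G → A} {ω' : G →L[ℂ] A} {X : G} (hω : HasFDerivAt ω ω' X) :
    HasFDerivAt (fun Y => L (ω Y)) (L.toContinuousLinearMap.comp ω') X :=
  (L.toContinuousLinearMap.hasFDerivAt (x := ω X)).comp X hω

theorem HasFDerivAt.curryLeft_apply {E F G : Type*} [NormedAddCommGroup E] [NormedSpace ℂ E]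
    [NormedAddCommGroup F] [NormedSpace ℂ F] [NormedAddCommGroup G] [NormedSpace ℂ G] {k : ℕ}
    {ω : G → E [⋀^Fin (k + 1)]→L[ℂ] F} {ω' : G →L[ℂ] E [⋀^Fin (k + 1)]→L[ℂ] F}
    {V : G → E} {V' : G →L[ℂ] E} {X : G} (hω : HasFDerivAt ω ω' X) (hV : HasFDerivAt V V' X) :
    HasFDerivAt (fun Y => (ω Y).curryLeft (V Y))
      (((ω X).curryLeft).comp V' +
        ((ContinuousAlternatingMap.curryLeftLI (𝕜 := ℂ) (E := E) (F := F)
          (n := k)).toContinuousLinearMap.comp ω').flip (V X)) X := by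
  have h1 := HasFDerivAt.comp_linearIsometry (A := E [⋀^Fin (k + 1)]→L[ℂ] F)
    (B := E →L[ℂ] E [⋀^Fin k]→L[ℂ] F) (ContinuousAlternatingMap.curryLeftLI (𝕜 := ℂ)
    (E := E) (F := F) (n := k)) hω
  exact h1.clm_apply hV

variable {k : ℕ}

/-- Cartan's formula `d ι_V ω = L_V ω - ι_V d ω`. -/
theorem extDeriv_contractForm {V : ToricSpace → ToricSpace}
    {ω : ToricSpace → ToricSpace [⋀^Fin (k + 1)]→L[ℂ] ℂ} {X : ToricSpace}
    (hω : DifferentiableAt ℂ ω X) (hV : DifferentiableAt ℂ V X) :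
    extDeriv (contractForm V ω) X =
      lieDerivForm V ω X - contractForm V (extDeriv ω) X := by
  ext v
  have h1 := (hω.hasFDerivAt.curryLeft_apply hV.hasFDerivAt).fderiv
  change ContinuousAlternatingMap.alternatizeUncurryFin
    (fderiv ℂ (fun Y => (ω Y).curryLeft (V Y)) X) v = _
  rw [h1]
  simp only [extDeriv, contractForm, lieDerivForm,
    ContinuousAlternatingMap.alternatizeUncurryFin_apply]
  simp only [ContinuousAlternatingMap.sub_apply, ContinuousAlternatingMap.add_apply,
    ContinuousAlternatingMap.curryLeft_apply_apply,
    ContinuousAlternatingMap.alternatizeUncurryFin_apply]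
  -- The zeroth term of `ι_V dω` is `D_V ω`. The later ones carry an extra sign and cancel the terms
  -- of `d ι_V ω` in which `ω` is differentiated.
  rw [Fin.sum_univ_succ (n := k + 1)]
  -- Putting `DV (v i)` in slot `i` is an insertion into the remaining vectors; moving it to the
  -- first slot gives the sign `(-1)^i` of the exterior derivative.
  have h2 : ∀ i : Fin (k + 1), (fun j => (Function.update
      (fun _ => ContinuousLinearMap.id ℂ ToricSpace) i (fderiv ℂ V X) j) (v j)) =
      i.insertNth (fderiv ℂ V X (v i)) (i.removeNth v) := by
    intro i
    rw [Fin.insertNth_removeNth]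
    funext j
    by_cases hj : j = i
    · subst hj; simp
    · simp [hj]
  have h3 : ∀ i : Fin (k + 1), i.succ.removeNth (Matrix.vecCons (V X) v) =
      Matrix.vecCons (V X) (i.removeNth v) := fun i => by
    funext j
    refine Fin.cases ?_ (fun j => ?_) j <;> simp [Fin.removeNth]
  simp only [ContinuousAlternatingMap.fderivCompContinuousLinearMap_apply, h2, h3,
    ContinuousAlternatingMap.map_insertNth]
  simp [Finset.sum_add_distrib, pow_succ]

end Cartan

/-! ### Lie derivatives of top forms along the coordinate fields. -/

theorem single_mul_eq {ι : Type*} [DecidableEq ι] (i : ι) (x : ι → ℂ) (c : ℂ) :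
    (Pi.single i c : ι → ℂ) * x = Pi.single i (c * x i) := by
  funext j
  by_cases h : j = i
  · subst h; simp
  · simp [h]

/-- The projection of `ToricSpace` onto the `j`-th coordinate axis. -/
noncomputable def coordProj (j : Fin 4) : ToricSpace →L[ℂ] ToricSpace :=
  (ContinuousLinearMap.single ℂ (fun _ : Fin 4 => ℂ) j).comp (ContinuousLinearMap.proj j)

theorem coordField_eq (j : Fin 4) : coordField j = coordProj j := by
  funext X
  simp [coordField, coordProj]

theorem fderiv_coordField (j : Fin 4) (X : ToricSpace) :
    fderiv ℂ (coordField j) X = coordProj j := by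
  rw [coordField_eq]
  exact (coordProj j).fderiv

/-- The projections onto the coordinate axes act on top forms as derivations with trace `1`. -/
theorem fderivComp_coordProj (ω : ToricSpace [⋀^Fin 4]→L[ℂ] ℂ) (j : Fin 4) :
    ω.fderivCompContinuousLinearMap (ContinuousLinearMap.id ℂ ToricSpace) (coordProj j) = ω := by
  apply ContinuousAlternatingMap.toAlternatingMap_injective
  refine Module.Basis.ext_alternating (Pi.basisFun ℂ (Fin 4)) fun σ hσ => ?_
  -- Four distinct basis vectors include `e_j` exactly once; only that slot survives the projection.
  obtain ⟨i₀, hi₀⟩ := Finite.surjective_of_injective hσ j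
  simp only [ContinuousAlternatingMap.coe_toAlternatingMap,
    ContinuousAlternatingMap.fderivCompContinuousLinearMap_apply, Pi.basisFun_apply]
  have key : ∀ i : Fin 4, (fun k => (Function.update
      (fun _ => ContinuousLinearMap.id ℂ ToricSpace) i (coordProj j) k)
        ((Pi.single (σ k) 1 : ToricSpace))) =
      Function.update (fun k => (Pi.single (σ k) 1 : ToricSpace)) i
        ((if i = i₀ then (1 : ℂ) else 0) • (Pi.single (σ i) 1 : ToricSpace)) := by
    intro i
    funext k
    by_cases hk : k = i
    · subst hk
      by_cases h : k = i₀
      · subst h; simp [coordProj, hi₀]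
      · have h' : j ≠ σ k := fun e => h (hσ (e.symm.trans hi₀.symm))
        simp [coordProj, h, h']
    · simp [hk]
  simp only [key, ContinuousAlternatingMap.map_update_smul, Function.update_eq_self]
  simp

/-- The extra `ω X` is the divergence `1` of `Xⱼ ∂/∂Xⱼ`. It later cancels the weight of `Xⱼ⁻¹`. -/
theorem lieDerivForm_coordField (ω : ToricSpace → ToricSpace [⋀^Fin 4]→L[ℂ] ℂ) (j : Fin 4)
    (X : ToricSpace) :
    lieDerivForm (coordField j) ω X = fderiv ℂ ω X (Pi.single j (X j)) + ω X := by
  rw [lieDerivForm, fderiv_coordField, fderivComp_coordProj]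
  rfl

theorem lieDerivForm_radialField (ω : ToricSpace → ToricSpace [⋀^Fin 4]→L[ℂ] ℂ)
    (X : ToricSpace) :
    lieDerivForm radialField ω X = ∑ j, lieDerivForm (coordField j) ω X := by
  have h : fderiv ℂ radialField X = ∑ j, coordProj j := by
    have h1 : radialField = ⇑(∑ j, coordProj j) := by
      funext X
      simp [radialField, coordField_eq, _root_.sum_apply]
    rw [h1]
    exact ContinuousLinearMap.fderiv _
  rw [lieDerivForm, h, map_sum, radialField, map_sum, ← Finset.sum_add_distrib]
  refine Finset.sum_congr rfl fun j _ => ?_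
  rw [lieDerivForm, fderiv_coordField]

/-- The operator `η ↦ L_{Xⱼ ∂/∂Xⱼ} η` on families of forms. -/
noncomputable def lieOp {p k : ℕ} (j : Fin 4) (η : FormFamily p k) : FormFamily p k :=
  fun a => lieDerivForm (coordField j) (η a)

theorem sum_lieCoeff_smul {p : ℕ} {F : Type*} [AddCommGroup F] [Module ℂ F] (i : Fin (p + 5))
    (g : Fin 4 → F) :
    ∑ j, lieCoeff p i j • g j = if i = 0 then -∑ j, g j
      else if h : i.val - 1 < 4 then g ⟨i.val - 1, h⟩ else 0 := by
  unfold lieCoeff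
  split_ifs with h0 h1
  · simp
  · have hi : ∀ j : Fin 4, (i = coordIdx p j) ↔ j = ⟨i.val - 1, h1⟩ := by
      intro j
      have : i.val ≠ 0 := fun h => h0 (Fin.ext h)
      simp only [coordIdx, Fin.ext_iff]
      omega
    simp [hi]
  · have hi : ∀ j : Fin 4, i ≠ coordIdx p j := by
      intro j h
      rw [h] at h1
      simp [coordIdx] at h1
    simp [hi]

/-- Replaces the case distinction by one linear combination, the shape used both to find the vector
field of `substOp i` and to collect Lie derivatives. -/
theorem substOp_eq {p : ℕ} (i : Fin (p + 5)) (η : FormFamily p 4) (a : ParamSpace p)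
    (X : ToricSpace) :
    substOp i η a X = eulerOp i η a X + ∑ j, lieCoeff p i j • lieOp j η a X := by
  have h := sum_lieCoeff_smul i fun j => lieOp j η a X
  refine Eq.trans ?_ (congrArg (eulerOp i η a X + ·) h.symm)
  unfold substOp
  split_ifs with h0 h1
  · rw [lieDerivForm_radialField, sub_eq_add_neg]
    rfl
  · rfl
  · exact (add_zero _).symm

/-! ### Operators on families that act as a derivation plus a scalar. -/

section Families

variable {p : ℕ} {F : Type*} [NormedAddCommGroup F] [NormedSpace ℂ F]

/-- Derivatives in one parameter, like those in `X` alone, become directional derivatives of a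
single function of `(a, X)`; their commutation is then a symmetry of one second derivative. -/
theorem smul_deriv_update_eq_weightedDeriv (i : Fin (p + 5)) {η : ParamSpace p → ToricSpace → F}
    {q : ParamSpace p × ToricSpace} (h : DifferentiableAt ℂ (Function.uncurry η) q) :
    q.1 i • deriv (fun t => η (Function.update q.1 i t) q.2) (q.1 i) =
      weightedDeriv (Pi.single i 1, 0) (Function.uncurry η) q := by
  obtain ⟨a, X⟩ := q
  have h1 : HasDerivAt (fun t => ((Function.update a i t, X) : ParamSpace p × ToricSpace))
      (Pi.single i 1, 0) (a i) :=
    (hasDerivAt_update a i (a i)).prodMk (hasDerivAt_const _ _)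
  have h2 : HasFDerivAt (Function.uncurry η) (fderiv ℂ (Function.uncurry η) (a, X))
      (Function.update a i (a i), X) := by
    simpa using h.hasFDerivAt
  have h3 : HasDerivAt (fun t => η (Function.update a i t) X)
    (fderiv ℂ (Function.uncurry η) (a, X) (Pi.single i 1, 0)) (a i) :=
    HasFDerivAt.comp_hasDerivAt (f := fun t => ((Function.update a i t, X) :
      ParamSpace p × ToricSpace)) (a i) h2 h1
  rw [h3.deriv, weightedDeriv, ← map_smul]
  congr 1
  rw [Prod.mk_mul_mk, single_mul_eq, Prod.smul_mk, ← Pi.single_smul]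
  simp

theorem fderiv_eq_weightedDeriv (j : Fin 4) {η : ParamSpace p → ToricSpace → F}
    {q : ParamSpace p × ToricSpace} (h : DifferentiableAt ℂ (Function.uncurry η) q) :
    fderiv ℂ (η q.1) q.2 (Pi.single j (q.2 j)) =
      weightedDeriv (0, Pi.single j 1) (Function.uncurry η) q := by
  obtain ⟨a, X⟩ := q
  have h1 : HasFDerivAt (fun Y : ToricSpace => ((a, Y) : ParamSpace p × ToricSpace))
      (ContinuousLinearMap.inr ℂ (ParamSpace p) ToricSpace) X := hasFDerivAt_prodMk_right a X
  have h2 : HasFDerivAt (η a) _ X := h.hasFDerivAt.comp X h1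
  rw [h2.fderiv, weightedDeriv, Prod.mk_mul_mk, single_mul_eq]
  simp

/-- `T` acts on families holomorphic on `U` as the derivative along the vector field
`q ↦ w * q`, plus the scalar `κ`. -/
def IsWeightedOp (U : Set (ParamSpace p × ToricSpace))
    (T : (ParamSpace p → ToricSpace → F) → ParamSpace p → ToricSpace → F)
    (w : ParamSpace p × ToricSpace) (κ : ℂ) : Prop :=
  ∀ η : ParamSpace p → ToricSpace → F, AnalyticOnNhd ℂ (Function.uncurry η) U → ∀ q ∈ U,
    T η q.1 q.2 = weightedDeriv w (Function.uncurry η) q + κ • η q.1 q.2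

variable {U : Set (ParamSpace p × ToricSpace)}

/-- An operator `E + ∑ⱼ cⱼ Lⱼ` with `E`, `Lⱼ` acting as derivatives plus scalars does so too. -/
theorem IsWeightedOp.add_sum_smul
    {E T : (ParamSpace p → ToricSpace → F) → ParamSpace p → ToricSpace → F}
    {L : Fin 4 → (ParamSpace p → ToricSpace → F) → ParamSpace p → ToricSpace → F}
    {w : ParamSpace p} (hE : IsWeightedOp U E (w, 0) 0)
    (hL : ∀ j, IsWeightedOp U (L j) (0, Pi.single j 1) 1) (c : Fin 4 → ℂ)
    (hT : ∀ η a X, T η a X = E η a X + ∑ j, c j • L j η a X) :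
    IsWeightedOp U T (w, c) (∑ j, c j) := fun η hη q hq => by
  rw [hT, hE η hη q hq]
  simp only [hL _ η hη q hq]
  have h : ((w, c) : ParamSpace p × ToricSpace) = (w, 0) + ∑ j, c j • (0, Pi.single j 1) := by
    refine Prod.ext ?_ ?_
    · simp [Prod.fst_sum]
    · simp only [Prod.snd_add, Prod.snd_sum, Prod.smul_snd, zero_add]
      funext j
      simp [Finset.sum_apply, Pi.single_apply]
  simp only [weightedDeriv, h, add_mul, Finset.sum_mul, map_add, map_sum, smul_mul_assoc,
    map_smul, smul_add, Finset.sum_add_distrib, Finset.sum_smul, one_smul, zero_smul, add_zero]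
  abel

namespace IsWeightedOp

variable {T S : (ParamSpace p → ToricSpace → F) → ParamSpace p → ToricSpace → F}
  {w w' : ParamSpace p × ToricSpace} {κ κ' : ℂ} {η η' : ParamSpace p → ToricSpace → F}

theorem analyticOnNhd [CompleteSpace F] (hT : IsWeightedOp U T w κ) (hU : IsOpen U)
    (hη : AnalyticOnNhd ℂ (Function.uncurry η) U) :
    AnalyticOnNhd ℂ (Function.uncurry (T η)) U :=
  ((hη.weightedDeriv w).add (hη.const_smul (c := κ))).congr hU
    fun q hq => (hT η hη q hq).symm

/-- A derivation sees only the germ, so equality on an open set suffices. This matters because the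
families are meaningful only on the regular locus. -/
theorem congr (hT : IsWeightedOp U T w κ) (hU : IsOpen U)
    (hη : AnalyticOnNhd ℂ (Function.uncurry η) U)
    (h : Set.EqOn (Function.uncurry η) (Function.uncurry η') U) :
    Set.EqOn (Function.uncurry (T η)) (Function.uncurry (T η')) U := fun q hq => by
  change T η q.1 q.2 = T η' q.1 q.2
  rw [hT η hη q hq, hT η' (hη.congr hU h) q hq,
    (h.eventuallyEq_of_mem (hU.mem_nhds hq)).weightedDeriv_eq w]
  congr 2
  exact h hq

theorem add_apply (hT : IsWeightedOp U T w κ) (hη : AnalyticOnNhd ℂ (Function.uncurry η) U)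
    (hη' : AnalyticOnNhd ℂ (Function.uncurry η') U) {q : ParamSpace p × ToricSpace} (hq : q ∈ U) :
    T (η + η') q.1 q.2 = T η q.1 q.2 + T η' q.1 q.2 := by
  rw [hT η hη q hq, hT η' hη' q hq, hT (η + η') (hη.add hη') q hq]
  have h := weightedDeriv_add (hη q hq).differentiableAt (hη' q hq).differentiableAt w
  rw [show Function.uncurry (η + η') =
    fun x => Function.uncurry η x + Function.uncurry η' x from rfl, h]
  simp only [Pi.add_apply, smul_add]
  abel

theorem smul_apply (hT : IsWeightedOp U T w κ) (hη : AnalyticOnNhd ℂ (Function.uncurry η) U)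
    (c : ℂ) {q : ParamSpace p × ToricSpace} (hq : q ∈ U) :
    T (c • η) q.1 q.2 = c • T η q.1 q.2 := by
  rw [hT η hη q hq, hT (c • η) (hη.const_smul (c := c)) q hq]
  rw [show Function.uncurry (c • η) = fun x => c • Function.uncurry η x from rfl,
    weightedDeriv_const_smul (hη q hq).differentiableAt c w]
  simp only [Pi.smul_apply, smul_add, smul_comm κ c]

theorem sub_smul_apply (hT : IsWeightedOp U T w κ) (hη : AnalyticOnNhd ℂ (Function.uncurry η) U)
    (hη' : AnalyticOnNhd ℂ (Function.uncurry η') U) (c : ℂ) {q : ParamSpace p × ToricSpace}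
    (hq : q ∈ U) :
    T (η - c • η') q.1 q.2 = T η q.1 q.2 - c • T η' q.1 q.2 := by
  have h : AnalyticOnNhd ℂ (Function.uncurry (-c • η')) U := hη'.const_smul (c := -c)
  rw [sub_eq_add_neg, ← neg_smul, hT.add_apply hη h hq, hT.smul_apply hη' _ hq, neg_smul,
    sub_eq_add_neg]

theorem sum_apply {ι : Type*} (hT : IsWeightedOp U T w κ) (s : Finset ι) {η : ι → ParamSpace p → ToricSpace → F}
    (hη : ∀ i, AnalyticOnNhd ℂ (Function.uncurry (η i)) U) {q : ParamSpace p × ToricSpace}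
    (hq : q ∈ U) : T (∑ i ∈ s, η i) q.1 q.2 = ∑ i ∈ s, T (η i) q.1 q.2 := by
  classical
  have h0 : AnalyticOnNhd ℂ (Function.uncurry (0 : ParamSpace p → ToricSpace → F)) U :=
    fun _ _ => analyticAt_const
  have hs : ∀ s : Finset ι, AnalyticOnNhd ℂ (Function.uncurry (∑ i ∈ s, η i)) U := by
    intro s
    induction s using Finset.induction_on with
    | empty => simpa using h0
    | insert a s ha ih => rw [Finset.sum_insert ha]; exact (hη a).add ih
  induction s using Finset.induction_on with
  | empty => simpa only [zero_smul, Finset.sum_empty] using hT.smul_apply h0 0 hq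
  | insert a s ha ih =>
    rw [Finset.sum_insert ha, Finset.sum_insert ha, hT.add_apply (hη a) (hs s) hq, ih]

theorem comm [CompleteSpace F] (hT : IsWeightedOp U T w κ) (hS : IsWeightedOp U S w' κ') (hU : IsOpen U)
    (hη : AnalyticOnNhd ℂ (Function.uncurry η) U) {q : ParamSpace p × ToricSpace} (hq : q ∈ U) :
    T (S η) q.1 q.2 = S (T η) q.1 q.2 := by
  have key : ∀ {T S : (ParamSpace p → ToricSpace → F) → ParamSpace p → ToricSpace → F}
      {w w' : ParamSpace p × ToricSpace} {κ κ' : ℂ}, IsWeightedOp U T w κ → IsWeightedOp U S w' κ' → T (S η) q.1 q.2 =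
      weightedDeriv w (weightedDeriv w' (Function.uncurry η)) q +
        κ' • weightedDeriv w (Function.uncurry η) q +
        κ • (weightedDeriv w' (Function.uncurry η) q + κ' • η q.1 q.2) := by
    intro T S w w' κ κ' hT hS
    rw [hT _ (hS.analyticOnNhd hU hη) q hq, hS η hη q hq]
    congr 1
    have h : Function.uncurry (S η) =ᶠ[nhds q] fun x =>
        weightedDeriv w' (Function.uncurry η) x + κ' • Function.uncurry η x :=
      Filter.eventuallyEq_of_mem (hU.mem_nhds hq) fun x hx => hS η hη x hx
    rw [h.weightedDeriv_eq, weightedDeriv_add (hη.weightedDeriv w' q hq).differentiableAt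
      ((hη q hq).differentiableAt.fun_const_smul κ'),
      weightedDeriv_const_smul (hη q hq).differentiableAt]
  rw [key hT hS, key hS hT, weightedDeriv_comm (hη q hq).contDiffAt]
  simp only [smul_add, smul_comm κ κ']
  abel

end IsWeightedOp

end Families

/-! ### The Euler, Lie and substituted operators as weighted derivations. -/

section Forms

variable {p : ℕ} {U : Set (ParamSpace p × ToricSpace)}

theorem isWeightedOp_eulerOp (i : Fin (p + 5)) :
    IsWeightedOp U (eulerOp (k := 4) i) (Pi.single i 1, 0) 0 := fun η hη q hq =>
  (smul_deriv_update_eq_weightedDeriv i (hη q hq).differentiableAt).trans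
    ((congrArg _ (zero_smul ℂ (η q.1 q.2))).trans (add_zero _)).symm

theorem isWeightedOp_lieOp (j : Fin 4) :
    IsWeightedOp U (lieOp (k := 4) j) (0, Pi.single j 1) 1 := fun η hη q hq =>
  (lieDerivForm_coordField (η q.1) j q.2).trans
    (congrArg₂ (· + ·) (fderiv_eq_weightedDeriv j (hη q hq).differentiableAt)
      (one_smul ℂ (η q.1 q.2)).symm)

theorem isWeightedOp_substOp (i : Fin (p + 5)) :
    IsWeightedOp U (substOp (k := 4) i) (Pi.single i 1, lieCoeff p i) (∑ j, lieCoeff p i j) :=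
  (isWeightedOp_eulerOp i).add_sum_smul isWeightedOp_lieOp (lieCoeff p i) (substOp_eq i)

end Forms

/-! ### Products of shifted operators and the collection of Lie derivatives. -/

section Lists

variable {p : ℕ} {F : Type*} [NormedAddCommGroup F] [NormedSpace ℂ F]

/-- The composite of the operators `T i - c` over a list of pairs `(i, c)`, the head acting last. -/
noncomputable def composeList
    (T : Fin (p + 5) → (ParamSpace p → ToricSpace → F) → ParamSpace p → ToricSpace → F)
    (fs : List (Fin (p + 5) × ℕ)) (ω : ParamSpace p → ToricSpace → F) :
    ParamSpace p → ToricSpace → F :=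
  fs.foldr (fun f η => T f.1 η - (f.2 : ℂ) • η) ω

/-- The coefficients collected when `∏ (S i - c)` is expanded for `S i = E i + ∑ⱼ c i j • Lⱼ`. -/
noncomputable def collectList
    (E S : Fin (p + 5) → (ParamSpace p → ToricSpace → F) → ParamSpace p → ToricSpace → F)
    (c : Fin (p + 5) → Fin 4 → ℂ) (j : Fin 4) (ω : ParamSpace p → ToricSpace → F) :
    List (Fin (p + 5) × ℕ) → ParamSpace p → ToricSpace → F
  | [] => 0
  | (i, s) :: fs => E i (collectList E S c j ω fs) - (s : ℂ) • collectList E S c j ω fs +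
      c i j • composeList S fs ω

theorem composeList_append (T : Fin (p + 5) → (ParamSpace p → ToricSpace → F) → ParamSpace p →
    ToricSpace → F) (fs gs : List (Fin (p + 5) × ℕ)) (ω : ParamSpace p → ToricSpace → F) :
    composeList T (fs ++ gs) ω = composeList T fs (composeList T gs ω) :=
  List.foldr_append

variable [CompleteSpace F] {U : Set (ParamSpace p × ToricSpace)}
  {E S T : Fin (p + 5) → (ParamSpace p → ToricSpace → F) → ParamSpace p → ToricSpace → F}
  {L : Fin 4 → (ParamSpace p → ToricSpace → F) → ParamSpace p → ToricSpace → F}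
  {w wE wS : Fin (p + 5) → ParamSpace p × ToricSpace} {κ κE κS : Fin (p + 5) → ℂ}
  {wL : Fin 4 → ParamSpace p × ToricSpace} {κL : Fin 4 → ℂ}
  {c : Fin (p + 5) → Fin 4 → ℂ}
  {ω ω' : ParamSpace p → ToricSpace → F}

theorem analyticOnNhd_composeList (hU : IsOpen U) (hT : ∀ i, IsWeightedOp U (T i) (w i) (κ i))
    (hω : AnalyticOnNhd ℂ (Function.uncurry ω) U) (fs : List (Fin (p + 5) × ℕ)) :
    AnalyticOnNhd ℂ (Function.uncurry (composeList T fs ω)) U := by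
  induction fs with
  | nil => exact hω
  | cons f fs ih => exact ((hT f.1).analyticOnNhd hU ih).sub (ih.const_smul (c := (f.2 : ℂ)))

theorem composeList_congr (hU : IsOpen U) (hT : ∀ i, IsWeightedOp U (T i) (w i) (κ i))
    (hω : AnalyticOnNhd ℂ (Function.uncurry ω) U)
    (h : Set.EqOn (Function.uncurry ω) (Function.uncurry ω') U) (fs : List (Fin (p + 5) × ℕ)) :
    Set.EqOn (Function.uncurry (composeList T fs ω)) (Function.uncurry (composeList T fs ω'))
      U := by
  induction fs with
  | nil => exact h
  | cons f fs ih =>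
    intro q hq
    exact congrArg₂ (· - ·)
      ((hT f.1).congr hU (analyticOnNhd_composeList hU hT hω fs) ih hq)
      (congrArg ((f.2 : ℂ) • ·) (ih hq))

/-- All factors are polynomials in the same `T i`, hence commute. In a block the largest constant
acts first, whereas the raising rule needs it to act last; this lemma reverses that. -/
theorem composeList_comm (hU : IsOpen U) (hT : ∀ i, IsWeightedOp U (T i) (w i) (κ i))
    (hω : AnalyticOnNhd ℂ (Function.uncurry ω) U) (i : Fin (p + 5)) (s : ℂ)
    (fs : List (Fin (p + 5) × ℕ)) (hfs : ∀ f ∈ fs, f.1 = i) :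
    Set.EqOn (Function.uncurry (composeList T fs (T i ω - s • ω)))
      (Function.uncurry (T i (composeList T fs ω) - s • composeList T fs ω)) U := by
  induction fs with
  | nil => exact fun _ _ => rfl
  | cons f fs ih =>
    intro q hq
    have ih' := ih fun f hf => hfs f (List.mem_cons_of_mem _ hf)
    have hi : f.1 = i := hfs f List.mem_cons_self
    have hη := analyticOnNhd_composeList hU hT hω fs
    have hTη := (hT i).analyticOnNhd hU hη
    have h0 : AnalyticOnNhd ℂ (Function.uncurry (composeList T fs (T i ω - s • ω))) U :=
      analyticOnNhd_composeList hU hT (ω := T i ω - s • ω)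
        (((hT i).analyticOnNhd hU hω).sub (hω.const_smul (c := s))) fs
    have h1 := (hT i).congr hU h0 ih' hq
    have h2 := ih' hq
    simp only [Function.uncurry, Pi.sub_apply, Pi.smul_apply] at h1 h2
    have h3 := (hT i).sub_smul_apply hTη hη s hq
    have h4 := (hT i).sub_smul_apply hTη hη (f.2 : ℂ) hq
    change T f.1 (composeList T fs (T i ω - s • ω)) q.1 q.2 -
        (f.2 : ℂ) • composeList T fs (T i ω - s • ω) q.1 q.2 =
      T i (T f.1 (composeList T fs ω) - (f.2 : ℂ) • composeList T fs ω) q.1 q.2 -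
        s • (T f.1 (composeList T fs ω) q.1 q.2 - (f.2 : ℂ) • composeList T fs ω q.1 q.2)
    rw [hi, h1, h2, h3, h4]
    simp only [smul_sub, smul_comm s (f.2 : ℂ)]
    abel

theorem analyticOnNhd_collectList (hU : IsOpen U) (hE : ∀ i, IsWeightedOp U (E i) (wE i) (κE i))
    (hS : ∀ i, IsWeightedOp U (S i) (wS i) (κS i))
    (hω : AnalyticOnNhd ℂ (Function.uncurry ω) U) (j : Fin 4) (fs : List (Fin (p + 5) × ℕ)) :
    AnalyticOnNhd ℂ (Function.uncurry (collectList E S c j ω fs)) U := by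
  induction fs with
  | nil => exact fun _ _ => analyticAt_const
  | cons f fs ih =>
    exact (((hE f.1).analyticOnNhd hU ih).sub (ih.const_smul (c := (f.2 : ℂ)))).add
      ((analyticOnNhd_composeList hU hS hω fs).const_smul (c := c f.1 j))

/-- Induction on the list. If the tail gives `η = e + ∑ⱼ Lⱼ kⱼ`, then `(S i - s) η` is `(E i - s) e
+ ∑ⱼ Lⱼ ((E i - s) kⱼ + c i j η)`, since `E i` commutes with `Lⱼ`; the bracket is the recursion of
`collectList`. -/
theorem composeList_eq_add_sum (hU : IsOpen U)
    (hE : ∀ i, IsWeightedOp U (E i) (wE i) (κE i))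
    (hS : ∀ i, IsWeightedOp U (S i) (wS i) (κS i))
    (hL : ∀ j, IsWeightedOp U (L j) (wL j) (κL j))
    (hSE : ∀ i η a X, S i η a X = E i η a X + ∑ j, c i j • L j η a X)
    (hω : AnalyticOnNhd ℂ (Function.uncurry ω) U) (fs : List (Fin (p + 5) × ℕ)) :
    Set.EqOn (Function.uncurry (composeList S fs ω))
      (Function.uncurry (composeList E fs ω + ∑ j, L j (collectList E S c j ω fs))) U := by
  induction fs with
  | nil =>
    intro q hq
    have h0 : AnalyticOnNhd ℂ (Function.uncurry (0 : ParamSpace p → ToricSpace → F)) U :=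
      fun _ _ => analyticAt_const
    have h : ∀ j, L j 0 q.1 q.2 = 0 := fun j => by
      simpa only [zero_smul] using (hL j).smul_apply h0 0 hq
    simp [Function.uncurry, composeList, collectList, Finset.sum_apply, h]
  | cons f fs ih =>
    obtain ⟨i, s⟩ := f
    intro q hq
    set η := composeList S fs ω with hη'
    set e := composeList E fs ω with he'
    set k := fun j => collectList E S c j ω fs with hk'
    have hη : AnalyticOnNhd ℂ (Function.uncurry η) U := analyticOnNhd_composeList hU hS hω fs
    have he : AnalyticOnNhd ℂ (Function.uncurry e) U := analyticOnNhd_composeList hU hE hω fs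
    have hk : ∀ j, AnalyticOnNhd ℂ (Function.uncurry (k j)) U := fun j =>
      analyticOnNhd_collectList hU hE hS hω j fs
    have hLk := fun j => (hL j).analyticOnNhd hU (hk j)
    have hsum : AnalyticOnNhd ℂ (Function.uncurry (∑ j, L j (k j))) U := by
      have h : Function.uncurry (∑ j, L j (k j)) = ∑ j, Function.uncurry (L j (k j)) := by
        funext x
        simp [Function.uncurry, Finset.sum_apply]
      rw [h]
      exact Finset.analyticOnNhd_sum _ fun j _ => hLk j
    have h1 : E i η q.1 q.2 = E i e q.1 q.2 + ∑ j, L j (E i (k j)) q.1 q.2 := by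
      rw [show E i η q.1 q.2 = E i (e + ∑ j, L j (k j)) q.1 q.2 from (hE i).congr hU hη ih hq,
        (hE i).add_apply he hsum hq, (hE i).sum_apply _ hLk hq]
      congr 1
      exact Finset.sum_congr rfl fun j _ => (hE i).comm (hL j) hU (hk j) hq
    have h2 : η q.1 q.2 = e q.1 q.2 + ∑ j, L j (k j) q.1 q.2 := by
      simpa [Function.uncurry, Finset.sum_apply] using ih hq
    have h3 : ∀ j, L j (E i (k j) - (s : ℂ) • k j + c i j • η) q.1 q.2 =
        L j (E i (k j)) q.1 q.2 - (s : ℂ) • L j (k j) q.1 q.2 + c i j • L j η q.1 q.2 := by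
      intro j
      have hEk := (hE i).analyticOnNhd hU (hk j)
      have ha : AnalyticOnNhd ℂ (Function.uncurry (E i (k j) - (s : ℂ) • k j)) U :=
        hEk.sub ((hk j).const_smul (c := (s : ℂ)))
      have hb : AnalyticOnNhd ℂ (Function.uncurry (c i j • η)) U := hη.const_smul (c := c i j)
      rw [(hL j).add_apply ha hb hq, (hL j).sub_smul_apply hEk (hk j) _ hq,
        (hL j).smul_apply hη _ hq]
    have h4 : (∑ j, L j (collectList E S c j ω ((i, s) :: fs))) q.1 q.2 =
        ∑ j, L j (E i (k j) - (s : ℂ) • k j + c i j • η) q.1 q.2 := by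
      simp only [Finset.sum_apply]
      rfl
    change S i η q.1 q.2 - (s : ℂ) • η q.1 q.2 = (E i e q.1 q.2 - (s : ℂ) • e q.1 q.2) +
      (∑ j, L j (collectList E S c j ω ((i, s) :: fs))) q.1 q.2
    rw [h4, hSE, h1, h2]
    simp only [h3, Finset.sum_add_distrib, Finset.sum_sub_distrib, smul_add, Finset.smul_sum]
    abel

end Lists

/-! ### Weights of the monomials of `f ∘ φ` and the raising rule. -/

section Monomials

variable {p : ℕ}

/-- The `k`-th monomial of `f ∘ φ`, as a function of `(a, X)`. -/
noncomputable def pulledMonomial (v : Fin (p + 5) → Fin 4 → ℤ) (k : Fin (p + 5))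
    (q : ParamSpace p × ToricSpace) : ℂ :=
  q.1 k * laurentMonomial (torusAut q.1 q.2) (v k)

/-- The function `f ∘ φ` of `(a, X)`. -/
noncomputable def pulledEq (v : Fin (p + 5) → Fin 4 → ℤ) (q : ParamSpace p × ToricSpace) : ℂ :=
  ∑ k, pulledMonomial v k q

/-- The points with `a₀, …, a₄ ≠ 0` and `X ∈ (ℂ^*)⁴`. -/
def torusLocus (p : ℕ) : Set (ParamSpace p × ToricSpace) :=
  {q | q.1 0 ≠ 0 ∧ (∀ j, q.1 (coordIdx p j) ≠ 0) ∧ ∀ j, q.2 j ≠ 0}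

theorem torusAut_ne_zero {q : ParamSpace p × ToricSpace} (hq : q ∈ torusLocus p) (j : Fin 4) :
    torusAut q.1 q.2 j ≠ 0 :=
  mul_ne_zero (div_ne_zero hq.1 (hq.2.1 j)) (hq.2.2 j)

theorem analyticAt_param (k : Fin (p + 5)) (q : ParamSpace p × ToricSpace) :
    AnalyticAt ℂ (fun q : ParamSpace p × ToricSpace => q.1 k) q :=
  ((ContinuousLinearMap.proj (R := ℂ) (φ := fun _ : Fin (p + 5) => ℂ) k).comp
    (ContinuousLinearMap.fst ℂ (ParamSpace p) ToricSpace)).analyticAt q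

theorem analyticAt_coord (j : Fin 4) (q : ParamSpace p × ToricSpace) :
    AnalyticAt ℂ (fun q : ParamSpace p × ToricSpace => q.2 j) q :=
  ((ContinuousLinearMap.proj (R := ℂ) (φ := fun _ : Fin 4 => ℂ) j).comp
    (ContinuousLinearMap.snd ℂ (ParamSpace p) ToricSpace)).analyticAt q

theorem analyticAt_pulledMonomial (v : Fin (p + 5) → Fin 4 → ℤ) (k : Fin (p + 5))
    {q : ParamSpace p × ToricSpace} (hq : q ∈ torusLocus p) :
    AnalyticAt ℂ (pulledMonomial v k) q := by
  refine (analyticAt_param k q).mul (Finset.analyticAt_fun_prod _ fun j _ => ?_)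
  exact (((analyticAt_param 0 q).div (analyticAt_param (coordIdx p j) q) (hq.2.1 j)).mul
    (analyticAt_coord j q)).zpow (torusAut_ne_zero hq j)

theorem analyticAt_pulledEq (v : Fin (p + 5) → Fin 4 → ℤ)
    {q : ParamSpace p × ToricSpace} (hq : q ∈ torusLocus p) : AnalyticAt ℂ (pulledEq v) q :=
  Finset.analyticAt_fun_sum _ fun k _ => analyticAt_pulledMonomial v k hq

section Weights

variable {w q : ParamSpace p × ToricSpace}

theorem hasWeightedDerivAt_param (k : Fin (p + 5)) :
    HasWeightedDerivAt w (fun q : ParamSpace p × ToricSpace => q.1 k) (w.1 k * q.1 k) q :=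
  HasWeightedDerivAt.clm ((ContinuousLinearMap.proj (R := ℂ) (φ := fun _ : Fin (p + 5) => ℂ) k).comp
    (ContinuousLinearMap.fst ℂ (ParamSpace p) ToricSpace))

theorem hasWeightedDerivAt_coord (j : Fin 4) :
    HasWeightedDerivAt w (fun q : ParamSpace p × ToricSpace => q.2 j) (w.2 j * q.2 j) q :=
  HasWeightedDerivAt.clm ((ContinuousLinearMap.proj (R := ℂ) (φ := fun _ : Fin 4 => ℂ) j).comp
    (ContinuousLinearMap.snd ℂ (ParamSpace p) ToricSpace))

theorem HasWeightedDerivAt.mul_eigen {g h : ParamSpace p × ToricSpace → ℂ} {c d : ℂ}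
    (hg : HasWeightedDerivAt w g (c * g q) q) (hh : HasWeightedDerivAt w h (d * h q) q) :
    HasWeightedDerivAt w (fun x => g x * h x) ((c + d) * (g q * h q)) q := by
  convert hg.mul hh using 1
  ring

theorem HasWeightedDerivAt.inv_eigen {g : ParamSpace p × ToricSpace → ℂ} {c : ℂ}
    (hg : HasWeightedDerivAt w g (c * g q) q) (h0 : g q ≠ 0) :
    HasWeightedDerivAt w (fun x => (g x)⁻¹) (-c * (g q)⁻¹) q := by
  simpa using hg.zpow h0 (-1)

theorem hasWeightedDerivAt_torusAut (hq : q ∈ torusLocus p) (j : Fin 4) :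
    HasWeightedDerivAt w (fun q : ParamSpace p × ToricSpace => torusAut q.1 q.2 j)
      ((w.1 0 - w.1 (coordIdx p j) + w.2 j) * torusAut q.1 q.2 j) q := by
  have h := ((hasWeightedDerivAt_param (w := w) (q := q) 0).mul_eigen
    ((hasWeightedDerivAt_param (coordIdx p j)).inv_eigen (hq.2.1 j))).mul_eigen
    (hasWeightedDerivAt_coord j)
  simp only [← div_eq_mul_inv, ← sub_eq_add_neg] at h
  exact h

/-- In this form `cᵢⱼ` is visibly the negative of the weight of `a₀ / aⱼ` under `aᵢ ∂/∂aᵢ`. -/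
theorem lieCoeff_eq (i : Fin (p + 5)) (j : Fin 4) :
    lieCoeff p i j = (Pi.single i 1 : ParamSpace p) (coordIdx p j) -
      (Pi.single i 1 : ParamSpace p) 0 := by
  have h : (0 : Fin (p + 5)) ≠ coordIdx p j := fun h => by
    simpa [coordIdx] using congrArg Fin.val h
  unfold lieCoeff
  simp only [Pi.single_apply]
  by_cases h0 : i = 0
  · subst h0
    simp [h.symm]
  · simp [h0, Ne.symm h0, eq_comm]

/-- The point of the substitution: the coordinates of `φ(X)` have weight `0`, so only the explicit
coefficient `a_k` contributes. -/
theorem hasWeightedDerivAt_pulledMonomial (v : Fin (p + 5) → Fin 4 → ℤ) (i k : Fin (p + 5))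
    (hq : q ∈ torusLocus p) :
    HasWeightedDerivAt (Pi.single i 1, lieCoeff p i) (pulledMonomial v k)
      ((Pi.single i 1 : ParamSpace p) k * pulledMonomial v k q) q := by
  have h1 : ∀ j, HasWeightedDerivAt (Pi.single i 1, lieCoeff p i)
      (fun q : ParamSpace p × ToricSpace => torusAut q.1 q.2 j)
      (0 * torusAut q.1 q.2 j) q := fun j => by
    convert hasWeightedDerivAt_torusAut hq j using 2
    change 0 = (Pi.single i 1 : ParamSpace p) 0 - (Pi.single i 1 : ParamSpace p) (coordIdx p j) +
      lieCoeff p i j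
    rw [lieCoeff_eq]
    ring
  have h2 := HasWeightedDerivAt.prod (s := Finset.univ) fun j _ =>
    (h1 j).zpow (torusAut_ne_zero hq j) (v k j)
  convert (hasWeightedDerivAt_param k).mul_eigen h2 using 1
  · rfl
  · simp [pulledMonomial, laurentMonomial]

theorem hasWeightedDerivAt_pulledEq (v : Fin (p + 5) → Fin 4 → ℤ) (i : Fin (p + 5))
    (hq : q ∈ torusLocus p) :
    HasWeightedDerivAt (Pi.single i 1, lieCoeff p i) (pulledEq v) (pulledMonomial v i q) q := by
  convert HasWeightedDerivAt.sum (s := Finset.univ) fun k _ =>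
    hasWeightedDerivAt_pulledMonomial v i k hq using 1
  · rfl
  · simp [Pi.single_apply]

end Weights

/-- The function `a₀ ∏ uₖ^{mₖ} ∏ Xⱼ⁻¹`, where `uₖ` are the monomials of `f ∘ φ`. -/
noncomputable def monomialFactor (v : Fin (p + 5) → Fin 4 → ℤ) (m : Fin (p + 5) → ℕ)
    (q : ParamSpace p × ToricSpace) : ℂ :=
  q.1 0 * (∏ k, pulledMonomial v k q ^ m k) * (∏ j, q.2 j)⁻¹

/-- The pullback under `φ` of `a₀ a^m ∂^m f⁻¹`, times `∏ Xⱼ⁻¹` and a constant vector. -/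
noncomputable def derivedPeriod {F : Type*} [AddCommGroup F] [Module ℂ F]
    (v : Fin (p + 5) → Fin 4 → ℤ) (ν : F) (m : Fin (p + 5) → ℕ) :
    ParamSpace p → ToricSpace → F :=
  fun a X => ((-1) ^ (∑ k, m k) * ((∑ k, m k).factorial : ℂ) *
    (monomialFactor v m (a, X) * (pulledEq v (a, X) ^ (∑ k, m k + 1))⁻¹)) • ν

/-- The three weights come from `a₀`, from `u^m` and from `∏ Xⱼ⁻¹`. -/
theorem hasWeightedDerivAt_monomialFactor (v : Fin (p + 5) → Fin 4 → ℤ) (m : Fin (p + 5) → ℕ)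
    (i : Fin (p + 5)) {q : ParamSpace p × ToricSpace} (hq : q ∈ torusLocus p) :
    HasWeightedDerivAt (Pi.single i 1, lieCoeff p i) (monomialFactor v m)
      (((Pi.single i 1 : ParamSpace p) 0 + m i - ∑ j, lieCoeff p i j) * monomialFactor v m q)
      q := by
  have h1 := HasWeightedDerivAt.prod (s := Finset.univ) fun k _ =>
    (hasWeightedDerivAt_pulledMonomial v i k hq).pow (m k)
  have h2 := (HasWeightedDerivAt.prod (s := Finset.univ) fun j _ =>
    hasWeightedDerivAt_coord (w := (Pi.single i 1, lieCoeff p i)) (q := q) j).inv_eigen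
    (Finset.prod_ne_zero_iff.2 fun j _ => hq.2.2 j)
  convert ((hasWeightedDerivAt_param (w := (Pi.single i 1, lieCoeff p i)) (q := q)
    (0 : Fin (p + 5))).mul_eigen h1).mul_eigen h2 using 1
  · rfl
  · simp [monomialFactor, Pi.single_apply, sub_eq_add_neg]

variable {F : Type*} [NormedAddCommGroup F] [NormedSpace ℂ F]

theorem analyticAt_derivedPeriod (v : Fin (p + 5) → Fin 4 → ℤ) (ν : F) (m : Fin (p + 5) → ℕ)
    {q : ParamSpace p × ToricSpace} (hq : q ∈ torusLocus p) (h0 : pulledEq v q ≠ 0) :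
    AnalyticAt ℂ (Function.uncurry (derivedPeriod v ν m)) q := by
  have h1 : AnalyticAt ℂ (monomialFactor v m) q :=
    ((analyticAt_param 0 q).mul (Finset.analyticAt_fun_prod _ fun k _ =>
      (analyticAt_pulledMonomial v k hq).fun_pow (m k))).mul
      ((Finset.analyticAt_fun_prod _ fun j _ => analyticAt_coord j q).inv
        (Finset.prod_ne_zero_iff.2 fun j _ => hq.2.2 j))
  have h2 := ((analyticAt_pulledEq v hq).fun_pow (∑ k, m k + 1)).inv (pow_ne_zero _ h0)
  exact (analyticAt_const.mul (h1.mul h2)).smul analyticAt_const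

/-- The raising rule. The scalar `∑ⱼ cᵢⱼ` cancels the weight of `∏ Xⱼ⁻¹`. Differentiating `(f ∘
φ)^(-(n+1))` yields `-(n+1) uᵢ (f ∘ φ)^(-(n+2))`, whose constant is absorbed by the normalisation
`(-1)^n n!`. -/
theorem weightedDeriv_derivedPeriod (v : Fin (p + 5) → Fin 4 → ℤ) (ν : F)
    (m : Fin (p + 5) → ℕ) (i : Fin (p + 5)) {q : ParamSpace p × ToricSpace}
    (hq : q ∈ torusLocus p) (h0 : pulledEq v q ≠ 0) :
    weightedDeriv (Pi.single i 1, lieCoeff p i) (Function.uncurry (derivedPeriod v ν m)) q +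
      (∑ j, lieCoeff p i j) • derivedPeriod v ν m q.1 q.2 =
    ((Pi.single i 1 : ParamSpace p) 0 + m i) • derivedPeriod v ν m q.1 q.2 +
      derivedPeriod v ν (m + Pi.single i 1) q.1 q.2 := by
  set n := ∑ k, m k with hn
  have hφ : HasDerivAt (fun z : ℂ => (z ^ (n + 1))⁻¹)
      (-((n + 1) * pulledEq v q ^ n) / (pulledEq v q ^ (n + 1)) ^ 2) (pulledEq v q) := by
    simpa using (hasDerivAt_pow (n + 1) (pulledEq v q)).fun_inv (pow_ne_zero _ h0)
  have h1 := ((HasWeightedDerivAt.const ((-1) ^ n * (n.factorial : ℂ))).mul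
    ((hasWeightedDerivAt_monomialFactor v m i hq).mul
      ((hasWeightedDerivAt_pulledEq v i hq).comp hφ))).smul (HasWeightedDerivAt.const ν)
  have hm : ∑ k, (m + Pi.single i 1 : Fin (p + 5) → ℕ) k = n + 1 := by
    simp [Finset.sum_add_distrib, hn]
  have hmono : monomialFactor v (m + Pi.single i 1) q =
      monomialFactor v m q * pulledMonomial v i q := by
    have : ∏ k, pulledMonomial v k q ^ (Pi.single i 1 : Fin (p + 5) → ℕ) k =
        pulledMonomial v i q := by
      rw [Finset.prod_eq_single i] <;> simp +contextual
    simp only [monomialFactor, Pi.add_apply, pow_add, Finset.prod_mul_distrib, this]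
    ring
  have h2 : weightedDeriv (Pi.single i 1, lieCoeff p i)
      (Function.uncurry (derivedPeriod v ν m)) q = _ := h1.2
  rw [h2]
  simp only [derivedPeriod, hm, ← hn, smul_zero, zero_add, smul_smul, ← add_smul, Prod.mk.eta,
    hmono, zero_mul, add_zero]
  congr 1
  rw [Nat.factorial_succ]
  push_cast
  field_simp
  ring

end Monomials

/-! ### Openness of the loci. -/

section Locus

variable {p : ℕ}

theorem isOpen_torusLocus : IsOpen (torusLocus p) := by
  have h1 : ∀ k : Fin (p + 5), IsOpen {q : ParamSpace p × ToricSpace | q.1 k ≠ 0} := fun k =>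
    isOpen_ne_fun (by fun_prop) continuous_const
  have h2 : ∀ j : Fin 4, IsOpen {q : ParamSpace p × ToricSpace | q.2 j ≠ 0} := fun j =>
    isOpen_ne_fun (by fun_prop) continuous_const
  simp only [torusLocus, Set.ofPred_and, Set.ofPred_forall]
  exact (h1 0).inter ((isOpen_iInter_of_finite fun j => h1 _).inter (isOpen_iInter_of_finite h2))

theorem regularLocus_subset_torusLocus (v : Fin (p + 5) → Fin 4 → ℤ) (l : Fin (p + 5) → ℤ) :
    regularLocus v l ⊆ torusLocus p := fun q hq => by
  refine ⟨hq.1 0 (Or.inl (Nat.zero_le _)), fun j => hq.1 _ (Or.inl ?_), hq.2.1⟩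
  simp only [coordIdx]
  omega

theorem isOpen_regularLocus (v : Fin (p + 5) → Fin 4 → ℤ) (l : Fin (p + 5) → ℤ) :
    IsOpen (regularLocus v l) := by
  have hc : ContinuousOn (pulledEq v) (torusLocus p) := fun q hq =>
    (analyticAt_pulledEq v hq).continuousAt.continuousWithinAt
  have h1 : IsOpen (torusLocus p ∩ pulledEq v ⁻¹' {0}ᶜ) :=
    hc.isOpen_inter_preimage isOpen_torusLocus isOpen_compl_singleton
  have h2 : IsOpen {q : ParamSpace p × ToricSpace | ∀ i, i.val ≤ 4 ∨ l i < 0 → q.1 i ≠ 0} := by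
    simp only [Set.ofPred_forall]
    exact isOpen_iInter_of_finite fun i => isOpen_iInter_of_finite fun _ =>
      isOpen_ne_fun (by fun_prop) continuous_const
  convert h2.inter h1 using 1
  ext q
  exact ⟨fun hq => ⟨hq.1, regularLocus_subset_torusLocus v l hq, hq.2.2⟩,
    fun hq => ⟨hq.1, hq.2.1.2.2, hq.2.2⟩⟩

end Locus

/-! ### The substituted products applied to the period. -/

section Factors

variable {p : ℕ} {F : Type*} [NormedAddCommGroup F] [NormedSpace ℂ F] [CompleteSpace F]
  {U : Set (ParamSpace p × ToricSpace)}
  {T : Fin (p + 5) → (ParamSpace p → ToricSpace → F) → ParamSpace p → ToricSpace → F}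
  {v : Fin (p + 5) → Fin 4 → ℤ} {ν : F}

/-- The factors of `gkzFactors` with a given index. -/
def gkzBlock (i : Fin (p + 5)) (r : ℕ) : List (Fin (p + 5) × ℕ) :=
  (List.range r).map fun j => (i, if i = 0 then j + 1 else j)

/-- Starting from exponent `0` at `i`, the constants of the block are successively `δᵢ₀` plus the
current exponent, so each factor raises the exponent by one. -/
theorem composeList_gkzBlock (hU : IsOpen U)
    (hUt : U ⊆ torusLocus p) (hUv : ∀ q ∈ U, pulledEq v q ≠ 0)
    (hT : ∀ i, IsWeightedOp U (T i) (Pi.single i 1, lieCoeff p i) (∑ j, lieCoeff p i j))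
    (m : Fin (p + 5) → ℕ) (i : Fin (p + 5)) (hi : m i = 0) (r : ℕ) :
    Set.EqOn (Function.uncurry (composeList T (gkzBlock i r) (derivedPeriod v ν m)))
      (Function.uncurry (derivedPeriod v ν (m + Pi.single i r))) U := by
  have han : ∀ m, AnalyticOnNhd ℂ (Function.uncurry (derivedPeriod v ν m)) U := fun m q hq =>
    analyticAt_derivedPeriod v ν m (hUt hq) (hUv q hq)
  induction r with
  | zero => simpa [gkzBlock, composeList] using Set.eqOn_refl _ U
  | succ r ih =>
    intro q hq
    have hb : gkzBlock i (r + 1) = gkzBlock i r ++ [(i, if i = 0 then r + 1 else r)] := by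
      simp [gkzBlock, List.range_succ]
    set s : ℕ := if i = 0 then r + 1 else r with hs
    have hs' : (s : ℂ) = (Pi.single i 1 : ParamSpace p) 0 +
        ((m + Pi.single i r : Fin (p + 5) → ℕ) i : ℕ) := by
      by_cases h : i = 0
      · subst h
        simp [hs, hi, add_comm]
      · simp [hs, hi, h, Ne.symm h]
    rw [hb, composeList_append]
    -- The new factor is innermost in the list; it is moved outside so that the induction hypothesis
    -- applies first.
    have h1 := composeList_comm hU hT (han m) i (s : ℂ) (gkzBlock i r)
      (fun f hf => by
        simp only [gkzBlock, List.mem_map] at hf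
        obtain ⟨_, _, rfl⟩ := hf
        rfl) hq
    refine h1.trans ?_
    have hA := analyticOnNhd_composeList hU hT (han m) (gkzBlock i r)
    have h2 := (hT i).congr hU hA ih hq
    have h3 := ih hq
    have h4 := hT i _ (han (m + Pi.single i r)) q hq
    rw [weightedDeriv_derivedPeriod v ν _ i (hUt hq) (hUv q hq), ← hs', add_assoc m,
      ← Pi.single_add] at h4
    simp only [Function.uncurry] at h2 h3 ⊢
    simp only [Pi.sub_apply, Pi.smul_apply, h2, h3, h4, add_sub_cancel_left]

theorem composeList_gkzFactors (hU : IsOpen U)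
    (hUt : U ⊆ torusLocus p) (hUv : ∀ q ∈ U, pulledEq v q ≠ 0)
    (hT : ∀ i, IsWeightedOp U (T i) (Pi.single i 1, lieCoeff p i) (∑ j, lieCoeff p i j))
    (m : Fin (p + 5) → ℕ) :
    Set.EqOn (Function.uncurry (composeList T (gkzFactors m) (derivedPeriod v ν 0)))
      (Function.uncurry (derivedPeriod v ν m)) U := by
  have han : ∀ m, AnalyticOnNhd ℂ (Function.uncurry (derivedPeriod v ν m)) U := fun m q hq =>
    analyticAt_derivedPeriod v ν m (hUt hq) (hUv q hq)
  -- Absence of repetitions guarantees that the block of `i` meets exponent `0` at `i`.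
  have key : ∀ L : List (Fin (p + 5)), L.Nodup →
      Set.EqOn (Function.uncurry (composeList T (L.flatMap fun i => gkzBlock i (m i))
        (derivedPeriod v ν 0)))
        (Function.uncurry (derivedPeriod v ν fun i => if i ∈ L then m i else 0)) U := by
    intro L hL
    induction L with
    | nil => exact fun _ _ => by simp [composeList]; rfl
    | cons i L ih =>
      rw [List.nodup_cons] at hL
      rw [List.flatMap_cons, composeList_append]
      have h1 := composeList_congr hU hT (analyticOnNhd_composeList hU hT (han 0) _) (ih hL.2)
        (gkzBlock i (m i))
      have h2 := composeList_gkzBlock (ν := ν) hU hUt hUv hT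
        (fun i => if i ∈ L then m i else 0) i (by simp [hL.1]) (m i)
      have h3 : (fun i => if i ∈ L then m i else 0) + Pi.single i (m i) =
          fun k => if k ∈ i :: L then m k else 0 := by
        funext k
        by_cases hk : k = i
        · subst hk; simp [hL.1]
        · simp [hk]
      rw [h3] at h2
      exact h1.trans h2
  have h := key _ (List.nodup_finRange (p + 5))
  simp only [List.mem_finRange, if_true] at h
  exact h

end Factors

/-! ### Consequences of the lattice relations. -/

section Relations

variable {p : ℕ} {v : Fin (p + 5) → Fin 4 → ℤ} {l : Fin (p + 5) → ℤ}

theorem sum_eq_zero_of_mem_relationLattice (hl : l ∈ relationLattice v) : ∑ k, l k = 0 := by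
  have h := congrArg Prod.fst (LinearMap.mem_ker.1 hl)
  simpa [Fintype.linearCombination_apply, Prod.fst_sum] using h

theorem sum_mul_eq_zero_of_mem_relationLattice (hl : l ∈ relationLattice v) (j : Fin 4) :
    ∑ k, v k j * l k = 0 := by
  have h := congrFun (congrArg Prod.snd (LinearMap.mem_ker.1 hl)) j
  simpa [Fintype.linearCombination_apply, Prod.snd_sum, mul_comm] using h

theorem prod_laurentMonomial_zpow (hl : l ∈ relationLattice v) {Y : ToricSpace}
    (hY : ∀ j, Y j ≠ 0) : ∏ k, laurentMonomial Y (v k) ^ l k = 1 := by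
  simp only [laurentMonomial, ← Finset.prod_zpow, ← zpow_mul]
  rw [Finset.prod_comm]
  refine Finset.prod_eq_one fun j _ => ?_
  have h : ∀ s : Finset (Fin (p + 5)), ∏ k ∈ s, Y j ^ (v k j * l k) =
      Y j ^ ∑ k ∈ s, v k j * l k := fun s => by
    classical
    induction s using Finset.induction_on with
    | empty => simp
    | insert a s ha ih => rw [Finset.prod_insert ha, Finset.sum_insert ha, zpow_add₀ (hY j), ih]
  rw [h, sum_mul_eq_zero_of_mem_relationLattice hl, zpow_zero]

/-- Formally `∏ u_k^{l_k} = a^l`, as `∑ l_k v_k = 0` removes the powers of `φ(X)`. Positive and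
negative exponents are kept apart because `u_k` is known to be nonzero only where `l_k < 0` provides
it. -/
theorem laurentMonomial_mul_prod_pulledMonomial (hl : l ∈ relationLattice v)
    {q : ParamSpace p × ToricSpace} (hq : q ∈ torusLocus p) (hql : ∀ k, l k < 0 → q.1 k ≠ 0) :
    laurentMonomial q.1 l * ∏ k, pulledMonomial v k q ^ (-l k).toNat =
      ∏ k, pulledMonomial v k q ^ (l k).toNat := by
  have hY := torusAut_ne_zero hq
  have hM : ∀ k, laurentMonomial (torusAut q.1 q.2) (v k) ≠ 0 := fun k =>
    Finset.prod_ne_zero_iff.2 fun j _ => zpow_ne_zero _ (hY j)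
  rw [← mul_one (laurentMonomial q.1 l), ← prod_laurentMonomial_zpow hl hY, laurentMonomial,
    ← Finset.prod_mul_distrib, ← Finset.prod_mul_distrib]
  refine Finset.prod_congr rfl fun k _ => ?_
  rw [← mul_zpow]
  change pulledMonomial v k q ^ l k * _ = _
  rcases lt_or_ge (l k) 0 with h | h
  · have h0 : pulledMonomial v k q ≠ 0 := mul_ne_zero (hql k h) (hM k)
    rw [← zpow_natCast, ← zpow_natCast, ← zpow_add₀ h0]
    congr 1
    omega
  · obtain ⟨n, hn⟩ := Int.eq_ofNat_of_zero_le h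
    simp [hn]

/-- `∑ l_k = 0` gives `|l⁺| = |l⁻|`, hence equal signs, factorials and powers of `f ∘ φ`; only the
monomials differ. -/
theorem derivedPeriod_relation {F : Type*} [AddCommGroup F] [Module ℂ F]
    (hl : l ∈ relationLattice v) (ν : F)
    {q : ParamSpace p × ToricSpace} (hq : q ∈ torusLocus p) (hql : ∀ k, l k < 0 → q.1 k ≠ 0) :
    derivedPeriod v ν (fun k => (l k).toNat) q.1 q.2 =
      laurentMonomial q.1 l • derivedPeriod v ν (fun k => (-l k).toNat) q.1 q.2 := by
  have hn : ∑ k, (l k).toNat = ∑ k, (-l k).toNat := by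
    have h : ∑ k, ((l k).toNat : ℤ) - ∑ k, ((-l k).toNat : ℤ) = 0 := by
      rw [← Finset.sum_sub_distrib, ← sum_eq_zero_of_mem_relationLattice hl]
      exact Finset.sum_congr rfl fun k _ => by omega
    have h' : ((∑ k, (l k).toNat : ℕ) : ℤ) = ((∑ k, (-l k).toNat : ℕ) : ℤ) := by
      push_cast
      exact sub_eq_zero.1 h
    exact_mod_cast h'
  simp only [derivedPeriod, monomialFactor, hn, smul_smul, Prod.mk.eta,
    ← laurentMonomial_mul_prod_pulledMonomial hl hq hql]
  congr 1
  ring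

end Relations

/-! ### Identification of `Π̃` with the zeroth derived period. -/

section Period

variable {p : ℕ}

theorem volumeForm_comp_diagonal (c : Fin 4 → ℂ) (A : ToricSpace →L[ℂ] ToricSpace)
    (hA : ∀ w j, A w j = c j * w j) :
    volumeForm.compContinuousLinearMap A = (∏ j, c j) • volumeForm := by
  ext w
  have h : (Matrix.of fun i => A (w i)) = Matrix.of fun i j => c j * Matrix.of w i j := by
    ext i j
    exact hA (w i) j
  exact (congrArg Matrix.det h).trans (Matrix.det_mul_row c (Matrix.of w))

theorem fderiv_torusAut_apply (a : ParamSpace p) (X w : ToricSpace) (j : Fin 4) :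
    fderiv ℂ (torusAut a) X w j = a 0 / a (coordIdx p j) * w j := by
  let A : ToricSpace →L[ℂ] ToricSpace :=
    ContinuousLinearMap.pi fun j => (a 0 / a (coordIdx p j)) • ContinuousLinearMap.proj j
  have h : torusAut a = A := by
    funext X j
    simp [A, torusAut]
  rw [h, A.fderiv]
  simp [A]

/-- The Jacobian `∏ a₀ / aⱼ` of `φ` cancels against the denominators `∏ φ(X)ⱼ`: the form `∏ dXⱼ /
Xⱼ` is invariant under the torus. -/
theorem modifiedPeriodForm_eq (v : Fin (p + 5) → Fin 4 → ℤ) {q : ParamSpace p × ToricSpace}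
    (hq : q ∈ torusLocus p) :
    modifiedPeriodForm v q.1 q.2 = derivedPeriod v volumeForm 0 q.1 q.2 := by
  have h1 : (∏ j, (q.1 0 / q.1 (coordIdx p j))) ≠ 0 :=
    Finset.prod_ne_zero_iff.2 fun j _ => div_ne_zero hq.1 (hq.2.1 j)
  have h2 : (periodForm v q.1 (torusAut q.1 q.2)).compContinuousLinearMap
      (fderiv ℂ (torusAut q.1) q.2) = ((hypersurfaceEq v q.1 (torusAut q.1 q.2))⁻¹ *
        (∏ j, torusAut q.1 q.2 j)⁻¹) • (∏ j, (q.1 0 / q.1 (coordIdx p j))) • volumeForm := by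
    rw [← volumeForm_comp_diagonal _ _ (fderiv_torusAut_apply q.1 q.2)]
    rfl
  have h3 : derivedPeriod v volumeForm 0 q.1 q.2 =
      (q.1 0 * (∏ j, q.2 j)⁻¹ * (hypersurfaceEq v q.1 (torusAut q.1 q.2))⁻¹) • volumeForm := by
    unfold derivedPeriod
    congr 1
    simp only [monomialFactor, Pi.zero_apply, Finset.sum_const_zero, pow_zero, pow_one,
      Nat.factorial_zero, Finset.prod_const_one, Nat.cast_one, zero_add, one_mul, mul_one]
    rfl
  rw [h3, modifiedPeriodForm, pullbackForm, h2]
  refine (congrArg (q.1 0 • ·) (smul_smul _ _ volumeForm)).trans ?_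
  refine (smul_smul _ _ volumeForm).trans ?_
  congr 1
  simp only [torusAut, Finset.prod_mul_distrib]
  field_simp

end Period

/-! ### Analyticity of contractions and exterior derivatives of sums. -/

section FormCalculus

variable {E F G : Type*} [NormedAddCommGroup E] [NormedSpace ℂ E] [NormedAddCommGroup F]
  [NormedSpace ℂ F] [NormedAddCommGroup G] [NormedSpace ℂ G]

theorem AnalyticAt.comp_linearIsometry (L : E →ₗᵢ[ℂ] F) {g : G → E} {x : G}
    (hg : AnalyticAt ℂ g x) : AnalyticAt ℂ (fun y => L (g y)) x :=
  (L.toContinuousLinearMap.analyticAt (g x)).comp hg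

theorem AnalyticAt.apply_apply {g : G → E →L[ℂ] F} {h : G → E} {x : G}
    (hg : AnalyticAt ℂ g x) (hh : AnalyticAt ℂ h x) : AnalyticAt ℂ (fun y => g y (h y)) x :=
  ((ContinuousLinearMap.id ℂ (E →L[ℂ] F)).analyticAt_bilinear (g x, h x)).comp₂ hg hh

theorem AnalyticAt.curryLeft_apply {k : ℕ} {ω : G → E [⋀^Fin (k + 1)]→L[ℂ] F} {V : G → E} {x : G}
    (hω : AnalyticAt ℂ ω x) (hV : AnalyticAt ℂ V x) :
    AnalyticAt ℂ (fun y => (ω y).curryLeft (V y)) x := by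
  have h := AnalyticAt.comp_linearIsometry (E := E [⋀^Fin (k + 1)]→L[ℂ] F)
    (F := E →L[ℂ] E [⋀^Fin k]→L[ℂ] F) (ContinuousAlternatingMap.curryLeftLI (𝕜 := ℂ)
    (E := E) (F := F) (n := k)) hω
  exact h.apply_apply hV

theorem extDeriv_fun_sum {ι : Type*} {k : ℕ} (s : Finset ι) {ω : ι → E → E [⋀^Fin k]→L[ℂ] F}
    {x : E} (h : ∀ i ∈ s, DifferentiableAt ℂ (ω i) x) :
    extDeriv (fun y => ∑ i ∈ s, ω i y) x = ∑ i ∈ s, extDeriv (ω i) x := by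
  classical
  induction s using Finset.induction_on with
  | empty =>
    ext w
    simp [extDeriv, ContinuousAlternatingMap.alternatizeUncurryFin_apply]
  | insert a s ha ih =>
    have h' : ∀ i ∈ s, DifferentiableAt ℂ (ω i) x := fun i hi => h i (Finset.mem_insert_of_mem hi)
    simp only [Finset.sum_insert ha]
    rw [extDeriv_fun_add (h a (Finset.mem_insert_self a s)) (DifferentiableAt.fun_sum h'), ih h']

end FormCalculus

/-- Five vectors in a space of dimension four are linearly dependent. -/
theorem extDeriv_eq_zero_of_top (ω : ToricSpace → ToricSpace [⋀^Fin 4]→L[ℂ] ℂ)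
    (X : ToricSpace) : extDeriv ω X = 0 := by
  ext w
  refine (extDeriv ω X).toAlternatingMap.map_linearDependent w fun h => ?_
  simpa using h.fintype_card_le_finrank

/-! ### Assembly of the two statements. -/

section Main

variable {p : ℕ} {v : Fin (p + 5) → Fin 4 → ℤ} {l : Fin (p + 5) → ℤ}

theorem collectLie_eq_collectList (j : Fin 4) (ω : FormFamily p 4)
    (fs : List (Fin (p + 5) × ℕ)) :
    collectLie j ω fs = collectList eulerOp substOp (lieCoeff p) j ω fs := by
  induction fs with
  | nil => rfl
  | cons f fs ih =>
    rw [collectLie, ih]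
    rfl

theorem analyticOnNhd_laurentMonomial :
    AnalyticOnNhd ℂ (fun q : ParamSpace p × ToricSpace => laurentMonomial q.1 l)
      (regularLocus v l) := fun q hq => by
  refine Finset.analyticAt_fun_prod _ fun i _ => ?_
  rcases lt_or_ge (l i) 0 with h | h
  · exact (analyticAt_param i q).zpow (hq.1 i (Or.inr h))
  · obtain ⟨n, hn⟩ := Int.eq_ofNat_of_zero_le h
    simp only [hn, zpow_natCast]
    exact (analyticAt_param i q).fun_pow n

theorem pulledEq_ne_zero {q : ParamSpace p × ToricSpace} (hq : q ∈ regularLocus v l) :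
    pulledEq v q ≠ 0 := hq.2.2

theorem eqOn_modifiedPeriodForm : Set.EqOn
    (Function.uncurry (derivedPeriod v volumeForm 0)) (Function.uncurry (modifiedPeriodForm v))
    (regularLocus v l) := fun _ hq =>
  (modifiedPeriodForm_eq v (regularLocus_subset_torusLocus v l hq)).symm

theorem analyticOnNhd_derivedPeriod (m : Fin (p + 5) → ℕ) :
    AnalyticOnNhd ℂ (Function.uncurry (derivedPeriod v volumeForm m)) (regularLocus v l) :=
  fun _ hq => analyticAt_derivedPeriod v volumeForm m (regularLocus_subset_torusLocus v l hq)
    (pulledEq_ne_zero hq)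

theorem analyticOnNhd_modifiedPeriodForm :
    AnalyticOnNhd ℂ (Function.uncurry (modifiedPeriodForm v)) (regularLocus v l) :=
  (analyticOnNhd_derivedPeriod 0).congr (isOpen_regularLocus v l) eqOn_modifiedPeriodForm

theorem composeFactors_substOp (m : Fin (p + 5) → ℕ) : Set.EqOn
    (Function.uncurry (composeFactors substOp (gkzFactors m) (modifiedPeriodForm v)))
    (Function.uncurry (derivedPeriod v volumeForm m)) (regularLocus v l) := by
  have h1 := composeList_congr (isOpen_regularLocus v l) isWeightedOp_substOp
    (analyticOnNhd_derivedPeriod 0) (eqOn_modifiedPeriodForm (v := v)) (gkzFactors m)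
  have h2 := composeList_gkzFactors (ν := volumeForm) (isOpen_regularLocus v l)
    (regularLocus_subset_torusLocus v l) (fun _ => pulledEq_ne_zero) isWeightedOp_substOp m
  exact h1.symm.trans h2

theorem gkzOp_substOp (hl : l ∈ relationLattice v) {q : ParamSpace p × ToricSpace}
    (hq : q ∈ regularLocus v l) : gkzOp l substOp (modifiedPeriodForm v) q.1 q.2 = 0 := by
  have h := fun m => composeFactors_substOp (v := v) (l := l) m hq
  have h1 := derivedPeriod_relation hl volumeForm (regularLocus_subset_torusLocus v l hq)
    fun k hk => hq.1 k (Or.inr hk)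
  exact sub_eq_zero.2 ((h _).trans (h1.trans (congrArg (laurentMonomial q.1 l • ·) (h _).symm)))

theorem analyticOnNhd_collectLie (j : Fin 4) (fs : List (Fin (p + 5) × ℕ)) :
    AnalyticOnNhd ℂ (Function.uncurry (collectLie j (modifiedPeriodForm v) fs))
      (regularLocus v l) := by
  rw [collectLie_eq_collectList]
  exact analyticOnNhd_collectList (isOpen_regularLocus v l) isWeightedOp_eulerOp
    isWeightedOp_substOp analyticOnNhd_modifiedPeriodForm j fs

theorem analyticOnNhd_alphaForm (j : Fin 4) :
    AnalyticOnNhd ℂ (Function.uncurry (alphaForm v l j)) (regularLocus v l) := fun q hq =>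
  (analyticOnNhd_collectLie j _ q hq).sub
    ((analyticOnNhd_laurentMonomial q hq).smul (analyticOnNhd_collectLie j _ q hq))

theorem differentiableAt_of_analyticAt_uncurry {F : Type*} [NormedAddCommGroup F]
    [NormedSpace ℂ F] {η : ParamSpace p → ToricSpace → F} {q : ParamSpace p × ToricSpace}
    (h : AnalyticAt ℂ (Function.uncurry η) q) : DifferentiableAt ℂ (η q.1) q.2 :=
  (show DifferentiableAt ℂ (Function.uncurry η) (q.1, q.2) from h.differentiableAt).comp q.2
    (hasFDerivAt_prodMk_right q.1 q.2).differentiableAt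

/-- The Lie derivative acts at fixed `a`, so `a^l` is a constant for it. -/
theorem lieDerivForm_alphaForm (j : Fin 4) {q : ParamSpace p × ToricSpace}
    (hq : q ∈ regularLocus v l) :
    lieDerivForm (coordField j) (alphaForm v l j q.1) q.2 =
      lieOp j (collectLie j (modifiedPeriodForm v) (gkzFactors fun i => (l i).toNat)) q.1 q.2 -
      laurentMonomial q.1 l • lieOp j
        (collectLie j (modifiedPeriodForm v) (gkzFactors fun i => (-l i).toNat)) q.1 q.2 :=
  (isWeightedOp_lieOp (U := regularLocus v l) j).sub_smul_apply
    (analyticOnNhd_collectLie j _) (analyticOnNhd_collectLie j _) (laurentMonomial q.1 l) hq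

theorem composeFactors_substOp_eq (fs : List (Fin (p + 5) × ℕ)) {q : ParamSpace p × ToricSpace}
    (hq : q ∈ regularLocus v l) :
    composeFactors substOp fs (modifiedPeriodForm v) q.1 q.2 =
      composeFactors eulerOp fs (modifiedPeriodForm v) q.1 q.2 +
        ∑ j, lieOp j (collectLie j (modifiedPeriodForm v) fs) q.1 q.2 := by
  have h := composeList_eq_add_sum (isOpen_regularLocus v l) isWeightedOp_eulerOp
    isWeightedOp_substOp isWeightedOp_lieOp substOp_eq
    (analyticOnNhd_modifiedPeriodForm (v := v)) fs hq
  simp only [collectLie_eq_collectList]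
  refine h.trans ?_
  simp only [Function.uncurry, Pi.add_apply, Finset.sum_apply]
  rfl

theorem sub_smul_sum_eq {F ι : Type*} [AddCommGroup F] [Module ℂ F] {s : Finset ι} {c : ℂ}
    {S S' e e' : F} {f f' : ι → F} (h : S - c • S' = 0) (hS : S = e + ∑ j ∈ s, f j)
    (hS' : S' = e' + ∑ j ∈ s, f' j) : e - c • e' = -∑ j ∈ s, (f j - c • f' j) := by
  rw [hS, hS', smul_add, Finset.smul_sum] at h
  rw [Finset.sum_sub_distrib, ← sub_eq_zero, ← h]
  abel

theorem gkzOp_eulerOp (hl : l ∈ relationLattice v) {q : ParamSpace p × ToricSpace}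
    (hq : q ∈ regularLocus v l) : gkzOp l eulerOp (modifiedPeriodForm v) q.1 q.2 =
      -∑ j, lieDerivForm (coordField j) (alphaForm v l j q.1) q.2 := by
  simp only [lieDerivForm_alphaForm _ hq]
  exact sub_smul_sum_eq (gkzOp_substOp hl hq) (composeFactors_substOp_eq _ hq)
    (composeFactors_substOp_eq _ hq)

theorem differentiableAt_coordField (j : Fin 4) (X : ToricSpace) :
    DifferentiableAt ℂ (coordField j) X := by
  rw [coordField_eq]
  exact (coordProj j).differentiableAt

theorem extDeriv_betaForm {q : ParamSpace p × ToricSpace} (hq : q ∈ regularLocus v l) :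
    extDeriv (betaForm v l q.1) q.2 =
      ∑ j, lieDerivForm (coordField j) (alphaForm v l j q.1) q.2 := by
  have hα := fun j => differentiableAt_of_analyticAt_uncurry
    (analyticOnNhd_alphaForm (v := v) (l := l) j q hq)
  refine (extDeriv_fun_sum Finset.univ fun j _ => ((hα j).hasFDerivAt.curryLeft_apply
    (differentiableAt_coordField j q.2).hasFDerivAt).differentiableAt).trans
    (Finset.sum_congr rfl fun j _ => ?_)
  refine (extDeriv_contractForm (hα j) (differentiableAt_coordField j q.2)).trans ?_
  -- The term `ι_V dαⱼ` of Cartan's formula vanishes since `αⱼ` has top degree.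
  rw [contractForm, extDeriv_eq_zero_of_top]
  exact sub_zero _

theorem analyticOnNhd_betaForm :
    AnalyticOnNhd ℂ (Function.uncurry (betaForm v l)) (regularLocus v l) := fun q hq => by
  have hV : ∀ j, AnalyticAt ℂ (fun q : ParamSpace p × ToricSpace => coordField j q.2) q :=
    fun j => by
    simp only [coordField_eq]
    exact ContinuousLinearMap.analyticAt (𝕜 := ℂ) (E := ParamSpace p × ToricSpace)
      (F := ToricSpace) ((coordProj j).comp (ContinuousLinearMap.snd ℂ (ParamSpace p) ToricSpace)) q
  have h : ∀ j, AnalyticAt ℂ (fun q : ParamSpace p × ToricSpace =>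
      (alphaForm v l j q.1 q.2).curryLeft (coordField j q.2)) q := fun j =>
    (analyticOnNhd_alphaForm j q hq).curryLeft_apply (hV j)
  exact Finset.analyticAt_fun_sum (F := ToricSpace [⋀^Fin 3]→L[ℂ] ℂ) Finset.univ fun j _ => h j

end Main

theorem mainTheorem5 (p : ℕ) (v : Fin (p + 5) → Fin 4 → ℤ)
    (hv₀ : v 0 = 0) (hv : ∀ j : Fin 4, v (coordIdx p j) = Pi.single j 1)
    (l : Fin (p + 5) → ℤ) (hl : l ∈ relationLattice v) :
    AnalyticOnNhd ℂ (fun q : ParamSpace p × ToricSpace => modifiedPeriodForm v q.1 q.2)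
      (regularLocus v l) ∧
    (∀ q ∈ regularLocus v l, gkzOp l substOp (modifiedPeriodForm v) q.1 q.2 = 0) ∧
    (∀ j, AnalyticOnNhd ℂ (fun q : ParamSpace p × ToricSpace => alphaForm v l j q.1 q.2)
      (regularLocus v l)) ∧
    (∀ j, ∀ q ∈ regularLocus v l, extDeriv (alphaForm v l j q.1) q.2 = 0) ∧
    (∀ q ∈ regularLocus v l, gkzOp l eulerOp (modifiedPeriodForm v) q.1 q.2 =
      -∑ j, lieDerivForm (coordField j) (alphaForm v l j q.1) q.2) ∧
    AnalyticOnNhd ℂ (fun q : ParamSpace p × ToricSpace => betaForm v l q.1 q.2)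
      (regularLocus v l) ∧
    (∀ q ∈ regularLocus v l, gkzOp l eulerOp (modifiedPeriodForm v) q.1 q.2 =
      -extDeriv (betaForm v l q.1) q.2) :=
  ⟨analyticOnNhd_modifiedPeriodForm, fun _ => gkzOp_substOp hl, analyticOnNhd_alphaForm,
    fun _ _ _ => extDeriv_eq_zero_of_top _ _, fun _ => gkzOp_eulerOp hl, analyticOnNhd_betaForm,
    fun _ hq => (gkzOp_eulerOp hl hq).trans (congrArg Neg.neg (extDeriv_betaForm hq).symm)⟩
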